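/- Let $k$ be a field, $n\ge 3$, $S=k[x_1,\dots,x_n]$, and let $\Delta$ be the boundary of an $n$-gon, i.e. the simplicial complex on $\{1,\dots,n\}$ with faces $\emptyset$, the vertices $\{i\}$ and the edges $e_i=\{i,i+1\}$ (indices read cyclically). Let $k[\Delta]=S/I_\Delta$ be its Stanley–Reisner ring, where $I_\Delta$ is generated by the monomials $\prod_{i\in\sigma}x_i$ with $\sigma\notin\Delta$. A finitely generated $\mathbb Z^n$-graded $S$-module $M$ is called square-free if $M_{\mathbf a}=0$ for $\mathbf a\notin\mathbb N^n$ and multiplication by $x_i$ is a bijection $M_{\mathbf a}\to M_{\mathbf a+\mathbf e_i}$ for all $\mathbf a\in\mathbb N^n$ and all $i$ with $a_i\neq 0$. For $F\subseteq\{1,\dots,n\}$ write $M_F$ for the component of $M$ in degree $\sum_{i\in F}\mathbf e_i$. Let $\mathcal J$ be the set of isomorphism classes (as graded $S$-modules) of square-free modules $M$ such that: - $M$ is a module over $k[\Delta]$, i.e. $I_\Delta M=0$; - $M$ is indecomposable (nonzero and not the direct sum of two nonzero graded submodules); - $M$ is Cohen–Macaulay (there is an $M$-regular sequence in $(x_1,\dots,x_n)$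 whose length is the Krull dimension of $M$); - $M$ is locally of rank $1$, i.e. $\dim_k M_e=1$ for every edge $e$ of $\Delta$; - $M$ has multidegree $(0,\dots,0)$, i.e. $\dim_k M_{\{i\}}-1=0$ for every $i$. Let $X$ be the projective line over $k$ with the points $(0,1)$ and $(1,0)$ $n$-doubled: the quotient of the disjoint union of $n$ copies of $\mathbf P^1_k=\mathbf P^1(k)$, numbered $1,\dots,n$, by the identification of equal points of different copies whenever they are neither $(0,1)$ nor $(1,0)$. Then $\mathcal J$ is parametrized by $X$: there is a bijection $\Phi:X\to\mathcal J$ such that for every $i$, every point $(s,t)$ of the $i$-th copy of $\mathbf P^1_k$, and every module $M$ with class in $\mathcal J$, the class of $M$ is $\Phi(s,t)$ if and only if, in suitable bases of the one-dimensional spaces $M_{\{j\}}$ and $M_{e_j}$ ($1\le j\le n$), the multiplication maps $M_{\{j\}}\to M_{e_j}$ and $M_{\{j+1\}}\to M_{e_j}$ are both $1$ for $j\ne i$, while $M_{\{i\}}\to M_{e_i}$ is $s$ and $M_{\{i+1\}}\to M_{e_i}$ is $t$. -/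

import Mathlib

universe u

open MvPolynomial

noncomputable section

/-- The simplicial complex of the boundary of an `n`-gon: the vertices are the elements of `Fin n`
and the edges are `{i, i + 1}`, with indices read cyclically. -/
def polygonBoundary (n : ℕ) : AbstractSimplicialComplex (Fin n) :=
  Geometry.AbstractSimplicialComplex.ofSimpleGraph (SimpleGraph.cycleGraph n)

/-- The Stanley--Reisner ideal, spanned by the monomials `x^σ` for the non-faces `σ`.
(In Mathlib the empty face is not listed among the faces of a complex, but here it counts as one.) -/
def stanleyReisnerIdeal (k : Type u) [Field k] {n : ℕ} (Δ : AbstractSimplicialComplex (Fin n)) :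
    Ideal (MvPolynomial (Fin n) k) :=
  Ideal.span {f | ∃ σ : Finset (Fin n), σ.Nonempty ∧ σ ∉ Δ ∧ f = ∏ i ∈ σ, X i}

/-- The square-free multidegree of a subset of the vertices. -/
def faceDegree {n : ℕ} (F : Finset (Fin n)) : Fin n → ℤ := fun i => if i ∈ F then 1 else 0

/-- A square-free module over `S = k[x_1, ..., x_n]`: a finitely generated `ℤ^n`-graded
`S`-module, zero outside `ℕ^n`, such that multiplication by `x_i` is a bijection
`M_a → M_{a + e_i}` for all `a ∈ ℕ^n` and all `i` in the support of `a`. -/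
structure SquareFreeModule (k : Type u) [Field k] (n : ℕ) where
  carrier : Type u
  [addCommGroup : AddCommGroup carrier]
  [moduleField : Module k carrier]
  [modulePoly : Module (MvPolynomial (Fin n) k) carrier]
  [isScalarTower : IsScalarTower k (MvPolynomial (Fin n) k) carrier]
  finite : Module.Finite (MvPolynomial (Fin n) k) carrier
  /-- the graded components -/
  deg : (Fin n → ℤ) → Submodule k carrier
  isInternal : DirectSum.IsInternal deg
  X_smul_mem : ∀ (a : Fin n → ℤ) (i : Fin n), ∀ m ∈ deg a,
    (X i : MvPolynomial (Fin n) k) • m ∈ deg (a + Pi.single i 1)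
  deg_eq_bot : ∀ a : Fin n → ℤ, ¬ 0 ≤ a → deg a = ⊥
  bijOn : ∀ a : Fin n → ℤ, 0 ≤ a → ∀ i : Fin n, a i ≠ 0 →
    Set.BijOn (fun m : carrier => (X i : MvPolynomial (Fin n) k) • m)
      (deg a) (deg (a + Pi.single i 1))

namespace SquareFreeModule

attribute [instance] addCommGroup moduleField modulePoly isScalarTower

variable {k : Type u} [Field k] {n : ℕ}

/-- `M` is a module over the Stanley--Reisner ring `k[Δ] = S / I_Δ`. -/
def IsOver (M : SquareFreeModule k n) (Δ : AbstractSimplicialComplex (Fin n)) : Prop :=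
  stanleyReisnerIdeal k Δ ≤ Module.annihilator (MvPolynomial (Fin n) k) M.carrier

/-- `M` is Cohen--Macaulay: there is an `M`-regular sequence in the maximal graded ideal
`(x_1, ..., x_n)` whose length is the Krull dimension of `M`, i.e. depth and dimension agree. -/
def IsCM (M : SquareFreeModule k n) : Prop :=
  ∃ rs : List (MvPolynomial (Fin n) k),
    (∀ r ∈ rs, r ∈ idealOfVars (Fin n) k) ∧
    RingTheory.Sequence.IsRegular M.carrier rs ∧
    (rs.length : WithBot ℕ∞) = Module.supportDim (MvPolynomial (Fin n) k) M.carrier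

/-- A submodule is graded if it is generated by homogeneous elements. -/
def IsGradedSubmodule (M : SquareFreeModule k n)
    (N : Submodule (MvPolynomial (Fin n) k) M.carrier) : Prop :=
  N = Submodule.span (MvPolynomial (Fin n) k) {m | m ∈ N ∧ ∃ a, m ∈ M.deg a}

/-- `M` is nonzero and not a direct sum of two nonzero graded submodules. -/
def IsIndecomposable (M : SquareFreeModule k n) : Prop :=
  Nontrivial M.carrier ∧
    ∀ N N' : Submodule (MvPolynomial (Fin n) k) M.carrier,
      M.IsGradedSubmodule N → M.IsGradedSubmodule N' → IsCompl N N' → N = ⊥ ∨ N' = ⊥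

/-- `dim_k M_F = 1` for all edges `F` of `Δ`. -/
def IsLocallyRankOne (M : SquareFreeModule k n) (Δ : AbstractSimplicialComplex (Fin n)) : Prop :=
  ∀ F ∈ Δ, F.card = 2 → Module.finrank k (M.deg (faceDegree F)) = 1

/-- The multidegree `d_i = dim_k M_{{i}} - 1`. -/
def multidegree (M : SquareFreeModule k n) : Fin n → ℤ :=
  fun i => (Module.finrank k (M.deg (faceDegree {i})) : ℤ) - 1

/-- Isomorphism of graded `S`-modules (of degree `0`). -/
def Iso (M N : SquareFreeModule k n) : Prop :=
  ∃ f : M.carrier ≃ₗ[MvPolynomial (Fin n) k] N.carrier, ∀ a m, m ∈ M.deg a ↔ f m ∈ N.deg a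

/-- The structure maps of `M` on vertices and edges of the `n`-gon, in suitable bases of the
(one-dimensional) spaces `M_v` and `M_e`: with `e_j = {j, j + 1}`, both maps
`M_{{j}} → M_{e_j}` and `M_{{j + 1}} → M_{e_j}` are `1` for `j ≠ i`, while for the edge `e_i`
they are `s` and `t` respectively. Here `j + 1` is the cyclic successor `finRotate n j`. -/
def HasEdgeCoordinates (M : SquareFreeModule k n) (i : Fin n) (s t : k) : Prop :=
  ∃ b c : Fin n → M.carrier,
    (∀ j, b j ∈ M.deg (faceDegree {j}) ∧ b j ≠ 0) ∧
    (∀ j, c j ∈ M.deg (faceDegree {j, finRotate n j}) ∧ c j ≠ 0) ∧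
    (∀ j, j ≠ i → (X (finRotate n j) : MvPolynomial (Fin n) k) • b j = c j ∧
      (X j : MvPolynomial (Fin n) k) • b (finRotate n j) = c j) ∧
    (X (finRotate n i) : MvPolynomial (Fin n) k) • b i = s • c i ∧
    (X i : MvPolynomial (Fin n) k) • b (finRotate n i) = t • c i

end SquareFreeModule

/-- The indecomposable Cohen--Macaulay square-free modules over `k[Δ]`, locally of rank `1`, with
multidegree `(0, ..., 0)`. -/
def JacobianModule (k : Type u) [Field k] {n : ℕ} (Δ : AbstractSimplicialComplex (Fin n)) :
    Type (u + 1) :=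
  {M : SquareFreeModule k n //
    M.IsOver Δ ∧ M.IsIndecomposable ∧ M.IsCM ∧ M.IsLocallyRankOne Δ ∧ M.multidegree = 0}

instance JacobianModule.setoid (k : Type u) [Field k] {n : ℕ}
    (Δ : AbstractSimplicialComplex (Fin n)) : Setoid (JacobianModule k Δ) where
  r M N := M.1.Iso N.1
  iseqv :=
    { refl := fun _ => ⟨LinearEquiv.refl _ _, fun _ _ => Iff.rfl⟩
      symm := fun ⟨f, hf⟩ => ⟨f.symm, fun a m => by
        have h := hf a (f.symm m)
        rw [LinearEquiv.apply_symm_apply] at h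
        exact h.symm⟩
      trans := fun ⟨f, hf⟩ ⟨g, hg⟩ => ⟨f.trans g, fun a m =>
        (hf a m).trans (hg a (f m))⟩ }

/-- The isomorphism classes of indecomposable Cohen--Macaulay square-free modules over `k[Δ]`,
locally of rank `1`, with multidegree `(0, ..., 0)`. -/
def JacobianFamily (k : Type u) [Field k] {n : ℕ} (Δ : AbstractSimplicialComplex (Fin n)) :
    Type (u + 1) :=
  Quotient (JacobianModule.setoid k Δ)

/-- The points `(1,0)` and `(0,1)` of the projective line. -/
def IsCoordinatePoint {k : Type u} [Field k] (p : Projectivization k (Fin 2 → k)) : Prop :=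
  p = Projectivization.mk k ![1, 0] (by simp) ∨ p = Projectivization.mk k ![0, 1] (by simp)

/-- On `n` copies of the projective line, identify equal points of different copies if they are
neither `(1,0)` nor `(0,1)`. -/
instance doubledLineSetoid (k : Type u) [Field k] (n : ℕ) :
    Setoid (Fin n × Projectivization k (Fin 2 → k)) where
  r x y := x.2 = y.2 ∧ (x.1 = y.1 ∨ ¬ IsCoordinatePoint x.2)
  iseqv :=
    { refl := fun _ => ⟨rfl, Or.inl rfl⟩
      symm := fun {x y} ⟨h, h'⟩ => ⟨h.symm, by
        rcases h' with h' | h'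
        · exact Or.inl h'.symm
        · exact Or.inr (h ▸ h')⟩
      trans := fun {x y z} ⟨h, h'⟩ ⟨g, g'⟩ => ⟨h.trans g, by
        rcases h' with h' | h'
        · rcases g' with g' | g'
          · exact Or.inl (h'.trans g')
          · exact Or.inr (by rw [h]; exact g')
        · exact Or.inr h'⟩ }

/-- The projective line over `k` with the points `(0,1)` and `(1,0)` `n`-doubled: the union of `n`
projective lines, glued along the complements of these two points. -/
def DoubledLine (k : Type u) [Field k] (n : ℕ) : Type u :=
  Quotient (doubledLineSetoid k n)

/-- The inclusion of the `i`-th projective line. -/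
def DoubledLine.chart {k : Type u} [Field k] {n : ℕ} (i : Fin n)
    (p : Projectivization k (Fin 2 → k)) : DoubledLine k n :=
  Quotient.mk (doubledLineSetoid k n) (i, p)

/-- The isomorphism class of a module. -/
def JacobianFamily.mk {k : Type u} [Field k] {n : ℕ} {Δ : AbstractSimplicialComplex (Fin n)}
    (M : JacobianModule k Δ) : JacobianFamily k Δ :=
  Quotient.mk (JacobianModule.setoid k Δ) M

end

/-!
A square-free module `M` over the Stanley–Reisner ring of the `n`-gon with one-dimensional
components at the vertices and edges is described by the scalars `α_j : M_{{j}} → M_{e_j}` and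
`β_j : M_{{j+1}} → M_{e_j}` in chosen bases (`SquareFreeModule.HasEdgeMaps`), together with the
component of degree zero. For Cohen–Macaulay `M` the scalars determine the rest, and `M` is then
indecomposable if and only if at most one of them vanishes.

*Cohen–Macaulay modules are determined by their scalars.* Such a module has dimension two, hence a
regular sequence of length two in `(x_1, …, x_n)`. This gives the vanishing of the first Koszul
cohomology on the variables (`exists_X_smul_eq`): a family with `x_j m_i = x_i m_j` is of the form
`m_i = x_i w`. Consequently an element killed by all products of two distinct variables is zero
(`SquareFreeModule.eq_zero_of_X_smul_X_smul_eq_zero`): it would otherwise give elements divisible by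
all powers of one variable. The product `x_j x_{j+1} m` is a multiple of the basis element of
`M_{e_j}` by a unique polynomial in `x_j, x_{j+1}`, and these polynomials form a tuple in the model
`edgeModel α β`, the module of tuples of polynomials on the edges whose restrictions to the axis of
each vertex are in the ratio given by the scalars. The two consequences of depth two say that
this map is injective and surjective (`SquareFreeModule.HasEdgeMaps.iso_edgeModel`).

*The models.* If the two scalars at a vertex never both vanish, the model is Cohen–Macaulay with
parameters `∑ x_j x_{j+1}` and `∑ x_j` (`edgeModel_isCM`), over any field. Its decompositions are
seen from the cycle: two vertices at which a scalar vanishes cut the cycle into two arcs, and the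
tuples supported on the arcs are complementary summands (`edgeModel_not_isIndecomposable`); if
there is at most one such vertex, the edge components all lie in the same summand, and this
forces the other summand to vanish (`edgeModel_isIndecomposable`).

*Change of bases.* If the scalars at all edges other than `e_i` are nonzero, they can be made `1`,
by walking along the cycle without `e_i`
(`SquareFreeModule.HasEdgeMaps.exists_hasEdgeCoordinates`). The pair `(s, t)` of scalars that
remains at `e_i` matters only up to a common factor, and `s : t` is the invariant
`∏ α_j : ∏ β_j` (`SquareFreeModule.HasEdgeCoordinates.mul_eq_mul`). If `s` or `t` is zero, then the
edge `e_i` is an invariant too; otherwise any edge can take its place. This is the gluing of the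
`n` projective lines to the doubled line.
-/

noncomputable section

/-! ### The cycle -/

/-- The cyclic successor `j ↦ j + 1` on the vertices of the `n`-gon. -/
def cycSucc (n : ℕ) : Equiv.Perm (Fin n) := finRotate n

lemma cycSucc_val {n : ℕ} (j : Fin n) :
    (cycSucc n j : ℕ) = if (j : ℕ) + 1 = n then 0 else (j : ℕ) + 1 := by
  obtain _ | n := n
  · exact j.elim0
  · unfold cycSucc
    split_ifs with h
    · have : j = Fin.last n := Fin.ext (by simpa using h)
      rw [this, finRotate_last]; rfl
    · exact coe_finRotate_of_ne_last (fun h' => h (by simp [h']))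

lemma cycSucc_ne {n : ℕ} (hn : 3 ≤ n) (j : Fin n) : cycSucc n j ≠ j := by
  intro h
  have := cycSucc_val j
  rw [h] at this
  split_ifs at this <;> omega

lemma cycSucc_cycSucc_ne {n : ℕ} (hn : 3 ≤ n) (j : Fin n) : cycSucc n (cycSucc n j) ≠ j := by
  intro h
  have h1 := cycSucc_val j
  have h2 := cycSucc_val (cycSucc n j)
  rw [h] at h2
  split_ifs at h1 h2 <;> omega

/-- The edge `e_j = {j, j + 1}` of the `n`-gon. -/
def cycEdge {n : ℕ} (j : Fin n) : Finset (Fin n) := {j, cycSucc n j}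

lemma mem_cycEdge {n : ℕ} {j l : Fin n} : l ∈ cycEdge j ↔ l = j ∨ l = cycSucc n j := by
  simp [cycEdge]

lemma left_mem_cycEdge {n : ℕ} (j : Fin n) : j ∈ cycEdge j := mem_cycEdge.2 (Or.inl rfl)

lemma right_mem_cycEdge {n : ℕ} (j : Fin n) : cycSucc n j ∈ cycEdge j :=
  mem_cycEdge.2 (Or.inr rfl)

lemma card_cycEdge {n : ℕ} (hn : 3 ≤ n) (j : Fin n) : (cycEdge j).card = 2 :=
  Finset.card_pair (cycSucc_ne hn j).symm

lemma cycSucc_mem_cycEdge {n : ℕ} {j l : Fin n} :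
    cycSucc n j ∈ cycEdge l ↔ l = j ∨ l = cycSucc n j := by
  rw [mem_cycEdge, (cycSucc n).injective.eq_iff, eq_comm, or_comm, eq_comm (a := j)]

lemma eq_of_cycEdge_subset {n : ℕ} (hn : 3 ≤ n) {i j : Fin n} (h : cycEdge i ⊆ cycEdge j) :
    i = j := by
  have h1 := mem_cycEdge.1 (h (left_mem_cycEdge i))
  have h2 := mem_cycEdge.1 (h (right_mem_cycEdge i))
  rcases h1 with rfl | rfl
  · rfl
  · rcases h2 with h2 | h2
    · exact absurd h2 (cycSucc_cycSucc_ne hn j)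
    · exact absurd h2 (cycSucc_ne hn _)

lemma cycleGraph_adj_iff {n : ℕ} (hn : 3 ≤ n) {u v : Fin n} :
    (SimpleGraph.cycleGraph n).Adj u v ↔ v = cycSucc n u ∨ u = cycSucc n v := by
  obtain ⟨m, rfl⟩ : ∃ m, n = m + 2 := ⟨n - 2, by omega⟩
  rw [SimpleGraph.cycleGraph_adj]
  have h (a : Fin (m + 2)) : cycSucc (m + 2) a = a + 1 := by simp [cycSucc]
  rw [h, h, sub_eq_iff_eq_add', sub_eq_iff_eq_add', or_comm]

/-- The nonempty faces of the `n`-gon are the nonempty subsets of its edges. -/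
lemma mem_polygonBoundary {n : ℕ} (hn : 3 ≤ n) {σ : Finset (Fin n)} :
    σ ∈ polygonBoundary n ↔ σ.Nonempty ∧ ∃ j, σ ⊆ cycEdge j := by
  have key : ∀ j : Fin n, cycEdge j ∈ polygonBoundary n := by
    intro j
    refine Or.inr ⟨s(j, cycSucc n j), ?_, ?_⟩
    · exact (cycleGraph_adj_iff hn).2 (Or.inl rfl)
    · ext; simp [cycEdge]
  constructor
  · rintro (⟨v, rfl⟩ | ⟨e, he, rfl⟩)
    · exact ⟨by simp, v, by simp [left_mem_cycEdge]⟩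
    · induction e with
      | _ u v =>
      refine ⟨⟨u, by simp⟩, ?_⟩
      rcases (cycleGraph_adj_iff hn).1 he with h | h
      · exact ⟨u, by intro x; simp [mem_cycEdge, ← h]⟩
      · exact ⟨v, by intro x; simp [mem_cycEdge, ← h, or_comm]⟩
  · rintro ⟨h, j, hj⟩
    exact ((polygonBoundary n).isRelLowerSet_faces (key j)).2 hj h

lemma cycEdge_mem {n : ℕ} (hn : 3 ≤ n) (j : Fin n) : cycEdge j ∈ polygonBoundary n :=
  (mem_polygonBoundary hn).2 ⟨⟨j, left_mem_cycEdge j⟩, j, subset_rfl⟩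

lemma eq_cycEdge_of_mem {n : ℕ} (hn : 3 ≤ n) {σ : Finset (Fin n)} (h : σ ∈ polygonBoundary n)
    (h2 : σ.card = 2) : ∃ j, σ = cycEdge j := by
  obtain ⟨_, j, hj⟩ := (mem_polygonBoundary hn).1 h
  exact ⟨j, Finset.eq_of_subset_of_card_le hj (by rw [h2, card_cycEdge hn])⟩

/-- Removing one step leaves the cycle connected. -/
lemma cycle_connected {n : ℕ} {P : Fin n → Prop} {i : Fin n}
    (h : ∀ j, j ≠ i → (P j ↔ P (cycSucc n j))) (j j' : Fin n) : P j ↔ P j' := by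
  have hn : 0 < n := i.pos
  have low : ∀ m (hm : m < n), m ≤ i → (P ⟨m, hm⟩ ↔ P ⟨0, hn⟩) := by
    intro m
    induction m with
    | zero => intros; rfl
    | succ m ih =>
      intro hm hi
      rw [← ih (by omega) (by omega), h ⟨m, by omega⟩ (by intro h; simp [← h] at hi)]
      rw [show cycSucc n ⟨m, by omega⟩ = ⟨m + 1, hm⟩ from
        Fin.ext (by rw [cycSucc_val]; dsimp only; split_ifs <;> omega)]
  have high : ∀ m, m < n → n - 1 - m > i → (P ⟨n - 1 - m, by omega⟩ ↔ P ⟨0, hn⟩) := by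
    intro m
    induction m with
    | zero =>
      intro hm hi
      rw [h ⟨n - 1 - 0, by omega⟩ (by intro h; simp [← h] at hi)]
      rw [show cycSucc n ⟨n - 1 - 0, by omega⟩ = ⟨0, hn⟩ from
        Fin.ext (by rw [cycSucc_val]; dsimp only; split_ifs <;> omega)]
    | succ m ih =>
      intro hm hi
      rw [← ih (by omega) (by omega),
        h ⟨n - 1 - (m + 1), by omega⟩ (by intro h; simp [← h] at hi)]
      rw [show cycSucc n ⟨n - 1 - (m + 1), by omega⟩ = ⟨n - 1 - m, by omega⟩ from
        Fin.ext (by rw [cycSucc_val]; dsimp only; split_ifs <;> omega)]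
  have all : ∀ j, P j ↔ P ⟨0, hn⟩ := by
    intro j
    by_cases hj : (j : ℕ) ≤ i
    · exact low j j.2 hj
    · have := high (n - 1 - j) (by omega) (by omega)
      rwa [show (⟨n - 1 - (n - 1 - j), by omega⟩ : Fin n) = j from Fin.ext (by simp; omega)] at this
  rw [all j, all j']

/-- Removing two steps cuts the cycle into two nonempty arcs. -/
lemma exists_cycle_cut {n : ℕ} {i i' : Fin n} (hii : i ≠ i') :
    ∃ T : Finset (Fin n), (∃ j, j ∈ T) ∧ (∃ j, j ∉ T) ∧
      ∀ j, j ≠ i → j ≠ i' → (j ∈ T ↔ cycSucc n j ∈ T) := by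
  wlog h : i < i' generalizing i i'
  · obtain ⟨T, h1, h2, h3⟩ := this hii.symm (lt_of_le_of_ne (not_lt.1 h) hii.symm)
    exact ⟨T, h1, h2, fun j hj hj' => h3 j hj' hj⟩
  refine ⟨Finset.Ioc i i', ⟨i', by simpa using h⟩, ⟨i, by simp⟩, fun j hj hj' => ?_⟩
  have hv := cycSucc_val j
  simp only [Finset.mem_Ioc, Fin.lt_def, Fin.le_def] at *
  have h1 : (j : ℕ) ≠ i := fun h => hj (Fin.ext h)
  have h2 : (j : ℕ) ≠ i' := fun h => hj' (Fin.ext h)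
  split_ifs at hv <;> omega

/-- A multiplicative cochain on the cycle becomes a coboundary once one step is removed. -/
lemma exists_cycle_potential {G : Type*} [CommGroup G] {n : ℕ} (g : Fin n → G) (i : Fin n) :
    ∃ p : Fin n → G, ∀ j, j ≠ i → p (cycSucc n j) = g j * p j := by
  -- partial products along `0, 1, …`, divided by the total product beyond the removed step
  let L : Fin n → G := fun j => ∏ l ∈ Finset.Iio j, g l
  refine ⟨fun j => if j ≤ i then L j else L j / ∏ l, g l, fun j hj => ?_⟩
  have hv := cycSucc_val j
  have hne : (j : ℕ) ≠ i := fun h => hj (Fin.ext h)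
  by_cases h : (j : ℕ) + 1 = n
  · rw [if_pos h] at hv
    have h1 : L (cycSucc n j) = 1 := by
      refine Finset.prod_eq_one fun l hl => ?_
      rw [Finset.mem_Iio, Fin.lt_def, hv] at hl
      omega
    have h2 : g j * L j = ∏ l, g l := by
      have : (Finset.univ : Finset (Fin n)) = insert j (Finset.Iio j) := by
        ext l; simp; omega
      rw [this, Finset.prod_insert (by simp)]
    have h3 : ¬ j ≤ i := by rw [Fin.le_def]; omega
    have h4 : cycSucc n j ≤ i := by rw [Fin.le_def]; omega
    simp only [h3, h4, if_true, if_false, h1]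
    rw [← mul_div_assoc, h2, div_self']
  · rw [if_neg h] at hv
    have h1 : L (cycSucc n j) = g j * L j := by
      have : (Finset.Iio (cycSucc n j)) = insert j (Finset.Iio j) := by
        ext l
        simp only [Finset.mem_insert, Finset.mem_Iio, Fin.ext_iff, Fin.lt_def, hv]
        omega
      simp only [L]
      rw [this, Finset.prod_insert (by simp)]
    by_cases h2 : j ≤ i
    · have h3 : cycSucc n j ≤ i := by rw [Fin.le_def] at *; omega
      simp only [h2, h3, if_true, h1]
    · have h3 : ¬ cycSucc n j ≤ i := by rw [Fin.le_def] at *; omega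
      simp only [h2, h3, if_false, h1, mul_div_assoc]

/-! ### Setting variables to zero -/

section Restriction

variable {k : Type u} [Field k] {n : ℕ}

/-- The endomorphism of the polynomial ring setting the variables outside `F` to zero. -/
def restrictVars (F : Finset (Fin n)) : MvPolynomial (Fin n) k →ₐ[k] MvPolynomial (Fin n) k :=
  aeval fun i => if i ∈ F then X i else 0

@[simp] lemma restrictVars_X (F : Finset (Fin n)) (i : Fin n) :
    restrictVars F (X i : MvPolynomial (Fin n) k) = if i ∈ F then X i else 0 := by
  simp [restrictVars]

lemma restrictVars_monomial (F : Finset (Fin n)) (d : Fin n →₀ ℕ) (c : k) :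
    restrictVars F (monomial d c) = if d.support ⊆ F then monomial d c else 0 := by
  rw [restrictVars, aeval_monomial, Finsupp.prod]
  split_ifs with h
  · rw [monomial_eq, Finsupp.prod, algebraMap_eq]
    congr 1
    exact Finset.prod_congr rfl fun i hi => by rw [if_pos (h hi)]
  · obtain ⟨i, hi, hF⟩ := Finset.not_subset.1 h
    rw [Finset.prod_eq_zero hi, mul_zero]
    rw [if_neg hF, zero_pow (Finsupp.mem_support_iff.1 hi)]

lemma coeff_restrictVars (F : Finset (Fin n)) (d : Fin n →₀ ℕ) (f : MvPolynomial (Fin n) k) :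
    coeff d (restrictVars F f) = if d.support ⊆ F then coeff d f else 0 := by
  induction f using MvPolynomial.induction_on' with
  | monomial e c =>
    rw [restrictVars_monomial, coeff_monomial]
    by_cases hed : e = d
    · subst hed
      split_ifs <;> simp_all
    · split_ifs <;> simp [coeff_monomial, hed]
  | add p q hp hq => rw [map_add, coeff_add, hp, hq, coeff_add]; split_ifs <;> simp

lemma restrictVars_restrictVars (F G : Finset (Fin n)) (f : MvPolynomial (Fin n) k) :
    restrictVars F (restrictVars G f) = restrictVars (F ∩ G) f := by
  ext d
  simp only [coeff_restrictVars, Finset.subset_inter_iff]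
  split_ifs <;> simp_all

lemma restrictVars_of_subset {F G : Finset (Fin n)} (h : F ⊆ G) (f : MvPolynomial (Fin n) k) :
    restrictVars F (restrictVars G f) = restrictVars F f := by
  rw [restrictVars_restrictVars, Finset.inter_eq_left.2 h]

lemma X_dvd_of_restrictVars_eq_zero {F G : Finset (Fin n)} {i : Fin n}
    {f : MvPolynomial (Fin n) k} (hf : restrictVars F f = f) (hG : ∀ l ∈ F, l ≠ i → l ∈ G)
    (h : restrictVars G f = 0) : X i ∣ f := by
  rw [X_dvd_iff_modMonomial_eq_zero]
  ext d
  rw [coeff_zero]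
  by_cases hd : Finsupp.single i 1 ≤ d
  · rw [coeff_modMonomial_of_le _ hd]
  · rw [coeff_modMonomial_of_not_le _ hd]
    by_contra hc
    have h1 : d.support ⊆ F := by
      by_contra h1
      rw [← hf, coeff_restrictVars, if_neg h1] at hc
      exact hc rfl
    have h2 : d.support ⊆ G := fun l hl => hG l (h1 hl) (by
      rintro rfl
      rw [Finsupp.mem_support_iff] at hl
      exact hd (Finsupp.single_le_iff.2 (by omega)))
    have := coeff_restrictVars G d f
    rw [h, if_pos h2, coeff_zero] at this
    exact hc this.symm

lemma restrictVars_eq_rename_killCompl (F : Finset (Fin n)) (f : MvPolynomial (Fin n) k) :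
    restrictVars F f =
      rename (Subtype.val : F → Fin n) (killCompl Subtype.val_injective f) := by
  suffices h : (restrictVars F : MvPolynomial (Fin n) k →ₐ[k] MvPolynomial (Fin n) k) =
      (rename (Subtype.val : F → Fin n)).comp (killCompl Subtype.val_injective) from
    DFunLike.congr_fun h f
  apply algHom_ext
  intro i
  simp only [restrictVars_X, AlgHom.comp_apply]
  split_ifs with h
  · have : (X i : MvPolynomial (Fin n) k) = rename (Subtype.val : F → Fin n) (X ⟨i, h⟩) := by
      rw [rename_X]
    rw [this, killCompl_rename_app]
  · rw [killCompl, aeval_X, dif_neg (by simpa using h), map_zero]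

lemma killCompl_eq_zero_of_restrictVars {F : Finset (Fin n)} {f : MvPolynomial (Fin n) k}
    (h : restrictVars F f = 0) :
    killCompl (Subtype.val_injective : Function.Injective (Subtype.val : F → Fin n)) f = 0 := by
  rw [restrictVars_eq_rename_killCompl] at h
  exact rename_injective _ Subtype.val_injective (by rw [h, map_zero])

lemma killCompl_surjective (F : Finset (Fin n)) : Function.Surjective
    (killCompl (R := k) (Subtype.val_injective : Function.Injective (Subtype.val : F → Fin n))) :=
  fun p => ⟨rename Subtype.val p, killCompl_rename_app _ p⟩

end Restriction

/-! ### Homogeneous components of a square-free module -/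

/-- The exponent vector of a monomial, as a `ℤ^n`-degree. -/
def expDegree {n : ℕ} (d : Fin n →₀ ℕ) : Fin n → ℤ := fun i => d i

@[simp] lemma expDegree_zero {n : ℕ} : expDegree (0 : Fin n →₀ ℕ) = 0 := by
  ext; simp [expDegree]

lemma expDegree_add {n : ℕ} (d e : Fin n →₀ ℕ) :
    expDegree (d + e) = expDegree d + expDegree e := by
  ext; simp [expDegree]

lemma expDegree_single {n : ℕ} (i : Fin n) :
    expDegree (Finsupp.single i 1) = Pi.single i 1 := by
  ext j; by_cases h : j = i <;> simp [expDegree, h]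

lemma expDegree_nonneg {n : ℕ} (d : Fin n →₀ ℕ) : 0 ≤ expDegree d := fun i => by
  simp [expDegree]

lemma expDegree_injective {n : ℕ} : Function.Injective (expDegree (n := n)) := by
  intro d e h
  ext i
  have := congrFun h i
  simpa [expDegree] using this

lemma exists_expDegree {n : ℕ} {a : Fin n → ℤ} (h : 0 ≤ a) : ∃ d, a = expDegree d :=
  ⟨Finsupp.equivFunOnFinite.symm fun i => (a i).toNat, by
    ext i; simp only [expDegree, Finsupp.equivFunOnFinite_symm_apply_apply]
    exact (Int.toNat_of_nonneg (h i)).symm⟩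

lemma faceDegree_singleton {n : ℕ} (i : Fin n) : faceDegree {i} = Pi.single i 1 := by
  ext j; by_cases h : j = i <;> simp [faceDegree, h]

lemma faceDegree_insert {n : ℕ} {F : Finset (Fin n)} {i : Fin n} (h : i ∉ F) :
    faceDegree (insert i F) = faceDegree F + Pi.single i 1 := by
  ext j; by_cases hj : j = i
  · subst hj; simp [faceDegree, h]
  · simp [faceDegree, hj]

lemma faceDegree_nonneg {n : ℕ} (F : Finset (Fin n)) : 0 ≤ faceDegree F := fun i => by
  simp only [faceDegree, Pi.zero_apply]; split_ifs <;> simp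

namespace SquareFreeModule

variable {k : Type u} [Field k] {n : ℕ} (M : SquareFreeModule k n)

lemma C_smul (c : k) (m : M.carrier) : (C c : MvPolynomial (Fin n) k) • m = c • m := by
  rw [← algebraMap_eq, algebraMap_smul]

lemma monomial_smul (d : Fin n →₀ ℕ) (c : k) (m : M.carrier) :
    (monomial d c : MvPolynomial (Fin n) k) • m =
      c • (monomial d 1 : MvPolynomial (Fin n) k) • m := by
  rw [← C_smul, smul_smul, C_mul_monomial, mul_one]

lemma smul_smul_comm (c : k) (f : MvPolynomial (Fin n) k) (m : M.carrier) :
    f • c • m = c • f • m := by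
  rw [← C_smul, ← C_smul, smul_smul, smul_smul, mul_comm]

/-- The projection onto the component of degree `a`. -/
def comp (a : Fin n → ℤ) : M.carrier →ₗ[k] M.carrier :=
  (M.deg a).subtype ∘ₗ DirectSum.component k _ _ a ∘ₗ
    (LinearEquiv.ofBijective (DirectSum.coeLinearMap M.deg) M.isInternal).symm.toLinearMap

lemma comp_mem (a : Fin n → ℤ) (m : M.carrier) : M.comp a m ∈ M.deg a := by
  simp [comp]

variable {M}

lemma comp_of_mem {a : Fin n → ℤ} {m : M.carrier} (h : m ∈ M.deg a) : M.comp a m = m := by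
  change (((LinearEquiv.ofBijective (DirectSum.coeLinearMap M.deg) M.isInternal).symm m a :
    M.deg a) : M.carrier) = m
  rw [M.isInternal.ofBijective_coeLinearMap_of_mem h]

lemma comp_of_mem_ne {a b : Fin n → ℤ} (hab : a ≠ b) {m : M.carrier} (h : m ∈ M.deg b) :
    M.comp a m = 0 := by
  change (((LinearEquiv.ofBijective (DirectSum.coeLinearMap M.deg) M.isInternal).symm m a :
    M.deg a) : M.carrier) = 0
  rw [M.isInternal.ofBijective_coeLinearMap_of_mem_ne hab.symm h]
  rfl

variable (M) in
/-- Additive statements about `M` may be checked on homogeneous elements. -/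
lemma homogeneous_induction {P : M.carrier → Prop} (m : M.carrier)
    (hom : ∀ a, ∀ m ∈ M.deg a, P m) (add : ∀ m m', P m → P m' → P (m + m')) : P m := by
  have h : m ∈ iSup M.deg := by rw [M.isInternal.submodule_iSup_eq_top]; trivial
  exact Submodule.iSup_induction M.deg (motive := P) h hom (hom 0 0 (zero_mem _)) add

variable (M) in
lemma ext_comp {m m' : M.carrier} (h : ∀ a, M.comp a m = M.comp a m') : m = m' := by
  apply (LinearEquiv.ofBijective (DirectSum.coeLinearMap M.deg) M.isInternal).symm.injective
  apply DFinsupp.ext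
  intro a
  exact Subtype.ext (h a)

lemma monomial_smul_mem {a : Fin n → ℤ} {m : M.carrier} (h : m ∈ M.deg a) (d : Fin n →₀ ℕ) (c : k) :
    (monomial d c : MvPolynomial (Fin n) k) • m ∈ M.deg (a + expDegree d) := by
  rw [monomial_smul]
  refine Submodule.smul_mem _ _ ?_
  induction d using Finsupp.induction_linear generalizing a m with
  | zero => simpa using h
  | add d e hd he =>
    rw [← one_mul (1 : k), ← monomial_mul, mul_comm, mul_smul, expDegree_add, ← add_assoc]
    exact he (hd h)
  | single i r =>
    induction r generalizing a m with
    | zero => simpa using h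
    | succ r ih =>
      rw [Finsupp.single_add, ← one_mul (1 : k), ← monomial_mul, mul_comm, mul_smul, expDegree_add,
        add_comm (expDegree _), ← add_assoc, ← mul_smul, mul_comm, mul_smul]
      refine ih ?_
      rw [expDegree_single]
      exact M.X_smul_mem a i m h

/-- Multiplication by a monomial whose support lies in the support of the degree is bijective. -/
lemma bijOn_monomial (d : Fin n →₀ ℕ) {a : Fin n → ℤ} (ha : 0 ≤ a) (hd : ∀ i, d i ≠ 0 → a i ≠ 0) :
    Set.BijOn (fun m : M.carrier => (monomial d 1 : MvPolynomial (Fin n) k) • m)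
      (M.deg a) (M.deg (a + expDegree d)) := by
  have step : ∀ (d e : Fin n →₀ ℕ) (a : Fin n → ℤ),
      Set.BijOn (fun m : M.carrier => (monomial d 1 : MvPolynomial (Fin n) k) • m)
        (M.deg a) (M.deg (a + expDegree d)) →
      Set.BijOn (fun m : M.carrier => (monomial e 1 : MvPolynomial (Fin n) k) • m)
        (M.deg (a + expDegree d)) (M.deg (a + expDegree d + expDegree e)) →
      Set.BijOn (fun m : M.carrier => (monomial (d + e) 1 : MvPolynomial (Fin n) k) • m)
        (M.deg a) (M.deg (a + expDegree (d + e))) := by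
    intro d e a h1 h2
    rw [expDegree_add, ← add_assoc]
    refine (h2.comp h1).congr fun m _ => ?_
    simp only [Function.comp_apply]
    rw [smul_smul, monomial_mul, mul_one, add_comm]
  have key : ∀ (d e : Fin n →₀ ℕ) (a : Fin n → ℤ), 0 ≤ a → (∀ i, (d + e) i ≠ 0 → a i ≠ 0) →
      0 ≤ a + expDegree d ∧ ∀ i, e i ≠ 0 → (a + expDegree d) i ≠ 0 := by
    intro d e a ha h
    refine ⟨add_nonneg ha (expDegree_nonneg d), fun i hi => ?_⟩
    have h1 := h i (by simp [hi])
    have h2 : 0 ≤ a i := ha i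
    simp only [Pi.add_apply, expDegree]
    omega
  induction d using Finsupp.induction_linear generalizing a with
  | zero => simpa using! Set.bijOn_id (M.deg a : Set M.carrier)
  | add d e hd' he =>
    obtain ⟨h1, h2⟩ := key d e a ha hd
    exact step d e a (hd' ha (fun i hi => hd i (by simp [hi]))) (he h1 h2)
  | single i r =>
    induction r with
    | zero => simpa using! Set.bijOn_id (M.deg a : Set M.carrier)
    | succ r ih =>
      have hi : a i ≠ 0 := hd i (by simp)
      have h0 : ∀ j, Finsupp.single i r j ≠ 0 → a j ≠ 0 := by
        intro j hj
        obtain rfl : i = j := by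
          by_contra h
          simp [h] at hj
        exact hi
      rw [Finsupp.single_add]
      refine step _ _ _ (ih h0) ?_
      rw [expDegree_single]
      refine M.bijOn _ (add_nonneg ha (expDegree_nonneg _)) i ?_
      have h2 : 0 ≤ a i := ha i
      simp only [Pi.add_apply, expDegree]
      omega

lemma monomial_smul_eq_zero {d : Fin n →₀ ℕ} {a : Fin n → ℤ} (ha : 0 ≤ a)
    (hd : ∀ i, d i ≠ 0 → a i ≠ 0) {m : M.carrier} (hm : m ∈ M.deg a)
    (h : (monomial d 1 : MvPolynomial (Fin n) k) • m = 0) : m = 0 :=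
  (bijOn_monomial d ha hd).injOn hm (zero_mem _) (by simpa using h)

lemma comp_monomial_smul (d : Fin n →₀ ℕ) (c : k) (a : Fin n → ℤ) (m : M.carrier) :
    M.comp (a + expDegree d) ((monomial d c : MvPolynomial (Fin n) k) • m) =
      (monomial d c : MvPolynomial (Fin n) k) • M.comp a m := by
  induction m using M.homogeneous_induction with
  | hom b m hm =>
    by_cases hab : a = b
    · subst hab
      rw [comp_of_mem hm, comp_of_mem (monomial_smul_mem hm d c)]
    · rw [comp_of_mem_ne hab hm, smul_zero,
        comp_of_mem_ne (fun h => hab (add_right_cancel h)) (monomial_smul_mem hm d c)]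
  | add m m' h h' => rw [smul_add, map_add, h, h', map_add, smul_add]

lemma comp_X_smul (i : Fin n) (a : Fin n → ℤ) (m : M.carrier) :
    M.comp (a + Pi.single i 1) ((X i : MvPolynomial (Fin n) k) • m) =
      (X i : MvPolynomial (Fin n) k) • M.comp a m := by
  rw [← expDegree_single]
  exact comp_monomial_smul _ 1 a m

/-- The homogeneous components of the multiples of a homogeneous element. -/
lemma comp_smul_of_mem (f : MvPolynomial (Fin n) k) {a : Fin n → ℤ} {m : M.carrier}
    (hm : m ∈ M.deg a) (d : Fin n →₀ ℕ) :
    M.comp (a + expDegree d) (f • m) =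
      coeff d f • (monomial d 1 : MvPolynomial (Fin n) k) • m := by
  induction f using MvPolynomial.induction_on' with
  | monomial e c =>
    by_cases h : e = d
    · subst h
      rw [comp_of_mem (monomial_smul_mem hm e c), coeff_monomial, if_pos rfl, monomial_smul]
    · rw [coeff_monomial, if_neg h, zero_smul]
      refine comp_of_mem_ne (fun h' => h ?_) (monomial_smul_mem hm e c)
      exact (expDegree_injective (add_left_cancel h')).symm
  | add p q hp hq => rw [add_smul, map_add, hp, hq, coeff_add, add_smul]

/-- A nonzero homogeneous element of degree `F` is torsion-free over the polynomial ring in the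
variables from `F`. -/
lemma restrictVars_eq_zero_of_smul_eq_zero {F : Finset (Fin n)} {m : M.carrier}
    (hm : m ∈ M.deg (faceDegree F)) (h0 : m ≠ 0) {f : MvPolynomial (Fin n) k} (h : f • m = 0) :
    restrictVars F f = 0 := by
  ext d
  rw [coeff_restrictVars, coeff_zero]
  split_ifs with hd
  · have := comp_smul_of_mem f hm d
    rw [h, map_zero] at this
    refine (smul_eq_zero.1 this.symm).resolve_right fun h' => h0 ?_
    refine monomial_smul_eq_zero (faceDegree_nonneg F) (fun i hi => ?_) hm h'
    simp [faceDegree, hd (Finsupp.mem_support_iff.2 hi)]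
  · rfl

/-- A square-free module over `k[Δ]` vanishes in degrees whose support is not a face. -/
lemma IsOver.deg_eq_bot {Δ : AbstractSimplicialComplex (Fin n)} (hM : M.IsOver Δ)
    {a : Fin n → ℤ} (h : (Finset.univ.filter fun i => a i ≠ 0).Nonempty)
    (hΔ : (Finset.univ.filter fun i => a i ≠ 0) ∉ Δ) : M.deg a = ⊥ := by
  by_cases ha : 0 ≤ a
  swap
  · exact M.deg_eq_bot a ha
  rw [eq_bot_iff]
  intro m hm
  set σ := Finset.univ.filter fun i => a i ≠ 0 with hσ
  have h1 : (∏ i ∈ σ, X i : MvPolynomial (Fin n) k) • m = 0 :=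
    Module.mem_annihilator.1 (hM (Ideal.subset_span ⟨σ, h, hΔ, rfl⟩)) m
  have h2 : (∏ i ∈ σ, X i : MvPolynomial (Fin n) k) =
      monomial (∑ i ∈ σ, Finsupp.single i 1) 1 := by
    rw [monomial_sum_one]; rfl
  rw [h2] at h1
  refine monomial_smul_eq_zero ha (fun i hi => ?_) hm h1
  by_contra h3
  refine hi ?_
  rw [Finsupp.finsetSum_apply]
  refine Finset.sum_eq_zero fun j hj => ?_
  rw [Finsupp.single_apply, if_neg]
  rintro rfl
  simp [hσ, h3] at hj

/-- In a graded submodule, homogeneous components of elements are elements. -/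
lemma IsGradedSubmodule.comp_mem {N : Submodule (MvPolynomial (Fin n) k) M.carrier}
    (hN : M.IsGradedSubmodule N) {m : M.carrier} (hm : m ∈ N) (a : Fin n → ℤ) :
    M.comp a m ∈ N := by
  rw [hN] at hm
  suffices ∀ a, M.comp a m ∈ N from this a
  induction hm using Submodule.span_induction with
  | mem m h =>
    obtain ⟨h1, b, hb⟩ := h
    intro a
    by_cases hab : a = b
    · rw [hab, comp_of_mem hb]; exact h1
    · rw [comp_of_mem_ne hab hb]; exact zero_mem _
  | zero => simp
  | add x y _ _ hx hy => intro a; rw [map_add]; exact add_mem (hx a) (hy a)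
  | smul f x _ hx =>
    intro a
    induction f using MvPolynomial.induction_on' with
    | monomial d c =>
      have := comp_monomial_smul d c (a - expDegree d) x
      rw [sub_add_cancel] at this
      rw [this]
      exact N.smul_mem _ (hx _)
    | add p q hp hq => rw [add_smul, map_add]; exact add_mem hp hq

end SquareFreeModule

/-! ### Depth two -/

section Depth

variable {k : Type u} [Field k] {n : ℕ}

lemma exists_of_mem_idealOfVars {f : MvPolynomial (Fin n) k} (hf : f ∈ idealOfVars (Fin n) k) :
    ∃ c : Fin n → MvPolynomial (Fin n) k, f = ∑ i, c i * X i := by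
  obtain ⟨c, hc⟩ := Ideal.mem_span_range_iff_exists_fun.1 hf
  exact ⟨c, hc.symm⟩

/-- Vanishing of the first Koszul cohomology in depth two: a family `m_i` with
`x_j m_i = x_i m_j` is of the form `m_i = x_i w`. -/
lemma exists_X_smul_eq {M : Type*} [AddCommGroup M] [Module (MvPolynomial (Fin n) k) M]
    {f g : MvPolynomial (Fin n) k} (hf : f ∈ idealOfVars (Fin n) k)
    (hg : g ∈ idealOfVars (Fin n) k) (hf0 : ∀ m : M, f • m = 0 → m = 0)
    (hfg : ∀ u w : M, g • u = f • w → ∃ w', u = f • w')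
    (m : Fin n → M) (hm : ∀ i j, (X j : MvPolynomial (Fin n) k) • m i =
      (X i : MvPolynomial (Fin n) k) • m j) :
    ∃ w, ∀ i, (X i : MvPolynomial (Fin n) k) • w = m i := by
  obtain ⟨c, rfl⟩ := exists_of_mem_idealOfVars hf
  obtain ⟨d, rfl⟩ := exists_of_mem_idealOfVars hg
  have key : ∀ (c : Fin n → MvPolynomial (Fin n) k) (j : Fin n),
      (X j : MvPolynomial (Fin n) k) • ∑ i, c i • m i = (∑ i, c i * X i) • m j := by
    intro c j
    rw [Finset.smul_sum, Finset.sum_smul]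
    refine Finset.sum_congr rfl fun i _ => ?_
    rw [smul_comm, hm i j, smul_smul]
  -- `∑ c_i m_i` and `∑ d_i m_i` are the values that `f w` and `g w` would have
  obtain ⟨w, hw⟩ := hfg (∑ i, c i • m i) (∑ i, d i • m i) (by
    rw [Finset.sum_smul, Finset.smul_sum]
    refine Finset.sum_congr rfl fun j _ => ?_
    rw [mul_smul, key, smul_comm])
  refine ⟨w, fun j => ?_⟩
  rw [← sub_eq_zero]
  apply hf0
  rw [smul_sub, ← key c j, hw, smul_comm, sub_self]

namespace SquareFreeModule

variable {M : SquareFreeModule k n}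

/-- The two consequences of depth at least two that are used: no nonzero element is killed by all
variables, and the first Koszul cohomology on the variables vanishes. -/
lemma IsCM.koszul (hM : M.IsCM)
    (hdim : 2 ≤ Module.supportDim (MvPolynomial (Fin n) k) M.carrier) :
    (∀ m : M.carrier, (∀ i, (X i : MvPolynomial (Fin n) k) • m = 0) → m = 0) ∧
    ∀ m : Fin n → M.carrier, (∀ i j, (X j : MvPolynomial (Fin n) k) • m i =
        (X i : MvPolynomial (Fin n) k) • m j) →
      ∃ w, ∀ i, (X i : MvPolynomial (Fin n) k) • w = m i := by
  obtain ⟨rs, hrs, hreg, hlen⟩ := hM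
  rw [← hlen] at hdim
  obtain _ | ⟨f, _ | ⟨g, rs⟩⟩ := rs
  · exact absurd hdim (by norm_cast)
  · exact absurd hdim (by norm_cast)
  have hw := hreg.toIsWeaklyRegular
  rw [RingTheory.Sequence.isWeaklyRegular_cons_iff,
    RingTheory.Sequence.isWeaklyRegular_cons_iff] at hw
  obtain ⟨h1, h2, -⟩ := hw
  have hf0 : ∀ m : M.carrier, f • m = 0 → m = 0 := fun m hm => h1 (by simpa using hm)
  have hf := hrs f (by simp)
  refine ⟨fun m hm => hf0 m ?_, exists_X_smul_eq hf (hrs g (by simp)) hf0 ?_⟩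
  · obtain ⟨c, rfl⟩ := exists_of_mem_idealOfVars hf
    rw [Finset.sum_smul]
    exact Finset.sum_eq_zero fun i _ => by rw [mul_smul, hm, smul_zero]
  · intro u w huw
    have h3 : g • (Submodule.Quotient.mk u : QuotSMulTop f M.carrier) = 0 := by
      rw [← Submodule.Quotient.mk_smul, Submodule.Quotient.mk_eq_zero, huw]
      exact Submodule.smul_mem_pointwise_smul _ _ _ trivial
    have h4 : (Submodule.Quotient.mk u : QuotSMulTop f M.carrier) = 0 := h2 (by simpa using h3)
    rw [Submodule.Quotient.mk_eq_zero] at h4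
    obtain ⟨w', -, h5⟩ := h4
    exact ⟨w', h5.symm⟩

/-- In depth two, an element killed by all variables but `x_v` vanishes: it generates a module of
dimension at most one. -/
lemma eq_zero_of_X_smul_eq_zero
    (hK : ∀ m : Fin n → M.carrier, (∀ i j, (X j : MvPolynomial (Fin n) k) • m i =
        (X i : MvPolynomial (Fin n) k) • m j) →
      ∃ w, ∀ i, (X i : MvPolynomial (Fin n) k) • w = m i)
    {v : Fin n} {m : M.carrier} (hm : ∀ q, q ≠ v → (X q : MvPolynomial (Fin n) k) • m = 0) :
    m = 0 := by
  -- such an element is divisible by all powers of `x_v`, while degrees are bounded below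
  suffices h : ∀ N : ℕ, ∀ m : M.carrier,
      (∀ q, q ≠ v → (X q : MvPolynomial (Fin n) k) • m = 0) →
      ∀ a : Fin n → ℤ, a v < N → M.comp a m = 0 by
    refine M.ext_comp fun a => ?_
    rw [map_zero]
    exact h ((a v).toNat + 1) m hm a (by push_cast; have := Int.self_le_toNat (a v); omega)
  intro N
  induction N with
  | zero =>
    intro m _ a ha
    have h1 : M.comp a m ∈ M.deg a := M.comp_mem a m
    rw [M.deg_eq_bot a (fun h => by have : 0 ≤ a v := h v; simp at ha; omega)] at h1
    exact h1
  | succ N ih =>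
    intro m hm a ha
    obtain ⟨w, hw⟩ := hK (fun i => if i = v then m else 0) (by
      intro i j
      by_cases hi : i = v <;> by_cases hj : j = v
      · rw [hi, hj]
      · simp [hi, hj, hm j hj]
      · simp [hi, hj, hm i hi]
      · simp [hi, hj])
    have h1 := hw v
    rw [if_pos rfl] at h1
    have h2 := comp_X_smul v (a - Pi.single v 1) w
    rw [sub_add_cancel, h1] at h2
    rw [h2, ih w (fun q hq => by rw [hw q, if_neg hq]) _ (by simp; push_cast at ha; omega),
      smul_zero]

/-- In depth two, an element killed by all products of two distinct variables vanishes. -/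
lemma eq_zero_of_X_smul_X_smul_eq_zero
    (h0 : ∀ m : M.carrier, (∀ i, (X i : MvPolynomial (Fin n) k) • m = 0) → m = 0)
    (hK : ∀ m : Fin n → M.carrier, (∀ i j, (X j : MvPolynomial (Fin n) k) • m i =
        (X i : MvPolynomial (Fin n) k) • m j) →
      ∃ w, ∀ i, (X i : MvPolynomial (Fin n) k) • w = m i)
    {m : M.carrier} (hm : ∀ p q, p ≠ q → (X p : MvPolynomial (Fin n) k) •
      (X q : MvPolynomial (Fin n) k) • m = 0) : m = 0 :=
  h0 m fun v => eq_zero_of_X_smul_eq_zero hK (v := v) fun q hq => hm q v hq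

end SquareFreeModule

end Depth

/-! ### Dimension -/

section Dimension

variable {k : Type u} [Field k] {n : ℕ}

lemma ringKrullDim_mvPolynomial_face (F : Finset (Fin n)) :
    ringKrullDim (MvPolynomial F k) = F.card := by
  rw [MvPolynomial.ringKrullDim_of_isNoetherianRing, ringKrullDim_eq_zero_of_field, zero_add]
  simp

/-- The ideal generated by the variables outside `F`. -/
def faceIdeal (k : Type u) [Field k] (F : Finset (Fin n)) : Ideal (MvPolynomial (Fin n) k) :=
  RingHom.ker (restrictVars (k := k) F)

lemma mem_faceIdeal {F : Finset (Fin n)} {f : MvPolynomial (Fin n) k} :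
    f ∈ faceIdeal k F ↔ restrictVars F f = 0 := RingHom.mem_ker

lemma faceIdeal_eq_ker_killCompl (F : Finset (Fin n)) : faceIdeal k F = RingHom.ker
    (killCompl (R := k) (Subtype.val_injective : Function.Injective (Subtype.val : F → Fin n))) := by
  ext f
  rw [mem_faceIdeal, RingHom.mem_ker]
  refine ⟨killCompl_eq_zero_of_restrictVars, fun h => ?_⟩
  rw [restrictVars_eq_rename_killCompl, h, map_zero]

lemma ringKrullDim_quotient_faceIdeal (F : Finset (Fin n)) :
    ringKrullDim (MvPolynomial (Fin n) k ⧸ faceIdeal k F) = F.card := by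
  rw [← ringKrullDim_mvPolynomial_face (k := k) F, faceIdeal_eq_ker_killCompl]
  exact ringKrullDim_eq_of_ringEquiv
    (RingHom.quotientKerEquivOfSurjective (f := (killCompl (R := k)
      (Subtype.val_injective : Function.Injective (Subtype.val : F → Fin n))).toRingHom)
      (killCompl_surjective F))

/-- The annihilator of a module that is nonzero in degree `F` lies in the prime ideal of `F`. -/
lemma SquareFreeModule.card_le_supportDim {M : SquareFreeModule k n} {F : Finset (Fin n)}
    {m : M.carrier} (hm : m ∈ M.deg (faceDegree F)) (h0 : m ≠ 0) :
    (F.card : WithBot ℕ∞) ≤ Module.supportDim (MvPolynomial (Fin n) k) M.carrier := by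
  have := M.finite
  rw [Module.supportDim_eq_ringKrullDim_quotient_annihilator,
    ← ringKrullDim_quotient_faceIdeal (k := k) F]
  have hle : Module.annihilator (MvPolynomial (Fin n) k) M.carrier ≤ faceIdeal k F := fun f hf =>
    mem_faceIdeal.2 (restrictVars_eq_zero_of_smul_eq_zero hm h0 (Module.mem_annihilator.1 hf m))
  exact ringKrullDim_le_of_surjective (Ideal.Quotient.factor hle)
    (Ideal.Quotient.factor_surjective hle)

/-- If the intersection of some face ideals annihilates `M`, then every prime ideal in the support
contains one of them. -/
lemma supportDim_le_of_forall_faceIdeal {M : Type*} [AddCommGroup M]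
    [Module (MvPolynomial (Fin n) k) M] {ι : Type*} [Fintype ι] (F : ι → Finset (Fin n)) {d : ℕ}
    (hF : ∀ i, (F i).card ≤ d)
    (h : ∀ f : MvPolynomial (Fin n) k, (∀ i, f ∈ faceIdeal k (F i)) → ∀ m : M, f • m = 0) :
    Module.supportDim (MvPolynomial (Fin n) k) M ≤ d := by
  refine iSup_le fun q => ?_
  have h1 : ∃ i, faceIdeal k (F i) ≤ q.head.1.asIdeal := by
    have h2 : ∏ i, faceIdeal k (F i) ≤ q.head.1.asIdeal := by
      intro f hf
      obtain ⟨m, hm⟩ := Module.mem_support_iff_exists_annihilator.1 q.head.2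
      refine hm ((Submodule.mem_annihilator_span_singleton _ _).2 (h f (fun i => ?_) m))
      exact (Ideal.prod_le_inf.trans (Finset.inf_le (Finset.mem_univ i))) hf
    obtain ⟨i, -, hi⟩ := (Ideal.IsPrime.prod_le q.head.1.2).1 h2
    exact ⟨i, hi⟩
  obtain ⟨i, hi⟩ := h1
  have h3 : ringKrullDim (MvPolynomial (Fin n) k ⧸ faceIdeal k (F i)) ≤ d := by
    rw [ringKrullDim_quotient_faceIdeal]
    exact_mod_cast hF i
  rw [ringKrullDim_quotient] at h3
  let q' : LTSeries (PrimeSpectrum.zeroLocus (R := MvPolynomial (Fin n) k)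
      (faceIdeal k (F i) : Set (MvPolynomial (Fin n) k))) :=
    { length := q.length
      toFun := fun l => ⟨(q l).1, fun x hx => (q.head_le l : q.head.1 ≤ (q l).1) (hi hx)⟩
      step := fun l => q.step l }
  exact (le_iSup (fun p : LTSeries _ => (p.length : WithBot ℕ∞)) q').trans h3

end Dimension

/-! ### The models -/

section Model

variable {k : Type u} [Field k] {n : ℕ}

/-- Tuples of polynomials indexed by the edges of the `n`-gon, where a polynomial acts on the
`j`-th entry after the variables outside the edge `e_j` are set to zero. -/
def EdgeFunctions (k : Type u) [Field k] (n : ℕ) : Type u := Fin n → MvPolynomial (Fin n) k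

namespace EdgeFunctions

instance : AddCommGroup (EdgeFunctions k n) :=
  inferInstanceAs (AddCommGroup (Fin n → MvPolynomial (Fin n) k))

instance : Module k (EdgeFunctions k n) :=
  inferInstanceAs (Module k (Fin n → MvPolynomial (Fin n) k))

/-- The entry of a tuple at the edge `e_j`. -/
def entry (j : Fin n) : EdgeFunctions k n →ₗ[k] MvPolynomial (Fin n) k :=
  LinearMap.proj (φ := fun _ : Fin n => MvPolynomial (Fin n) k) j

/-- The tuple with given entries. -/
def mk (f : Fin n → MvPolynomial (Fin n) k) : EdgeFunctions k n := f

@[simp] lemma entry_mk (f : Fin n → MvPolynomial (Fin n) k) (j : Fin n) :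
    entry j (mk f) = f j := rfl

lemma ext_entry {f g : EdgeFunctions k n} (h : ∀ j, entry j f = entry j g) : f = g := funext h

instance : SMul (MvPolynomial (Fin n) k) (EdgeFunctions k n) where
  smul r f := mk fun j => restrictVars (cycEdge j) r * entry j f

@[simp] lemma entry_smul (r : MvPolynomial (Fin n) k) (f : EdgeFunctions k n) (j : Fin n) :
    entry j (r • f) = restrictVars (cycEdge j) r * entry j f := rfl

instance : Module (MvPolynomial (Fin n) k) (EdgeFunctions k n) where
  one_smul f := ext_entry fun j => by rw [entry_smul, map_one, one_mul]
  mul_smul r s f := ext_entry fun j => by simp only [entry_smul, map_mul, mul_assoc]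
  smul_zero r := ext_entry fun j => by simp only [entry_smul, map_zero, mul_zero]
  smul_add r f g := ext_entry fun j => by simp only [entry_smul, map_add, mul_add]
  add_smul r s f := ext_entry fun j => by simp only [entry_smul, map_add, add_mul]
  zero_smul f := ext_entry fun j => by simp only [entry_smul, map_zero, zero_mul]

instance : IsScalarTower k (MvPolynomial (Fin n) k) (EdgeFunctions k n) where
  smul_assoc c r f := ext_entry fun j => by simp only [entry_smul, map_smul, smul_mul_assoc]

end EdgeFunctions

open EdgeFunctions

/-- The submodule of the tuples whose `j`-th entry is a polynomial in the variables of `e_j` and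
whose entries at the two edges through a vertex `j + 1` satisfy
`α_{j+1} f_j = β_j f_{j+1}` on the axis of `x_{j+1}`. -/
def edgeSubmodule (α β : Fin n → k) :
    Submodule (MvPolynomial (Fin n) k) (EdgeFunctions k n) where
  carrier := {f | ∀ j, restrictVars (cycEdge j) (entry j f) = entry j f ∧
    α (cycSucc n j) • restrictVars {cycSucc n j} (entry j f) =
      β j • restrictVars {cycSucc n j} (entry (cycSucc n j) f)}
  zero_mem' j := by simp
  add_mem' {f g} hf hg j := by
    simp only [map_add, smul_add, (hf j).1, (hg j).1, (hf j).2, (hg j).2, and_self]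
  smul_mem' r f hf j := by
    have h1 : ({cycSucc n j} : Finset (Fin n)) ⊆ cycEdge j := by simp [cycEdge]
    have h2 : ({cycSucc n j} : Finset (Fin n)) ⊆ cycEdge (cycSucc n j) := by simp [cycEdge]
    simp only [entry_smul, map_mul, restrictVars_of_subset subset_rfl, (hf j).1,
      restrictVars_of_subset h1, restrictVars_of_subset h2]
    refine ⟨trivial, ?_⟩
    rw [← mul_smul_comm, (hf j).2, mul_smul_comm]

variable {α β : Fin n → k}

lemma restrictVars_eq_self_iff {F : Finset (Fin n)} {f : MvPolynomial (Fin n) k} :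
    restrictVars F f = f ↔ ∀ d, ¬ d.support ⊆ F → coeff d f = 0 := by
  rw [MvPolynomial.ext_iff]
  refine forall_congr' fun d => ?_
  rw [coeff_restrictVars]
  split_ifs with h <;> simp [h, eq_comm]

/-- Membership in the model, coefficient by coefficient. -/
lemma mem_edgeSubmodule_iff {f : EdgeFunctions k n} : f ∈ edgeSubmodule α β ↔
    ∀ d j, (¬ d.support ⊆ cycEdge j → coeff d (entry j f) = 0) ∧
      (d.support ⊆ {cycSucc n j} →
        α (cycSucc n j) * coeff d (entry j f) = β j * coeff d (entry (cycSucc n j) f)) := by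
  change (∀ j, _ ∧ _) ↔ _
  rw [forall_comm]
  refine forall_congr' fun j => ?_
  rw [forall_and, restrictVars_eq_self_iff]
  refine and_congr_right fun _ => ?_
  rw [MvPolynomial.ext_iff]
  refine forall_congr' fun d => ?_
  rw [coeff_smul, coeff_smul, coeff_restrictVars, coeff_restrictVars]
  split_ifs with h <;> simp [h]

/-- The tuple of monomials `c_j x^d`. -/
def monomialTuple (d : Fin n →₀ ℕ) (c : Fin n → k) : EdgeFunctions k n :=
  mk fun j => monomial d (c j)

lemma monomialTuple_apply (d : Fin n →₀ ℕ) (c : Fin n → k) (j : Fin n) :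
    entry j (monomialTuple d c) = monomial d (c j) := rfl

lemma monomialTuple_mem {d : Fin n →₀ ℕ} {c : Fin n → k}
    (h1 : ∀ j, ¬ d.support ⊆ cycEdge j → c j = 0)
    (h2 : ∀ j, d.support ⊆ {cycSucc n j} → α (cycSucc n j) * c j = β j * c (cycSucc n j)) :
    monomialTuple d c ∈ edgeSubmodule α β := by
  rw [mem_edgeSubmodule_iff]
  intro e j
  simp only [monomialTuple_apply, coeff_monomial]
  by_cases h : d = e
  · subst h
    simpa only [if_true] using ⟨h1 j, h2 j⟩
  · simp [h]

variable (α β) in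
/-- The elements of the model that are homogeneous of degree `a`. -/
def edgeDeg (a : Fin n → ℤ) : Submodule k (edgeSubmodule α β) where
  carrier := {f | ∀ j d, coeff d (entry j f.1) ≠ 0 → expDegree d = a}
  zero_mem' j d h := absurd (by simp) h
  add_mem' {f g} hf hg j d h := by
    rw [Submodule.coe_add, map_add, coeff_add] at h
    by_cases h1 : coeff d (entry j f.1) = 0
    · rw [h1, zero_add] at h
      exact hg j d h
    · exact hf j d h1
  smul_mem' c f hf j d h := by
    rw [Submodule.coe_smul_of_tower, map_smul, coeff_smul] at h
    exact hf j d (right_ne_zero_of_smul h)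

lemma monomialTuple_mem_edgeDeg {d : Fin n →₀ ℕ} {c : Fin n → k}
    (h : monomialTuple d c ∈ edgeSubmodule α β) :
    (⟨monomialTuple d c, h⟩ : edgeSubmodule α β) ∈ edgeDeg α β (expDegree d) := by
  intro j e he
  simp only [monomialTuple_apply, coeff_monomial] at he
  split_ifs at he with h1
  · rw [h1]
  · exact absurd rfl he

lemma eq_monomialTuple_of_mem_edgeDeg {d : Fin n →₀ ℕ} {f : edgeSubmodule α β}
    (h : f ∈ edgeDeg α β (expDegree d)) : f.1 = monomialTuple d fun j => coeff d (entry j f.1) := by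
  refine ext_entry fun j => ?_
  rw [monomialTuple_apply]
  ext e
  rw [coeff_monomial]
  split_ifs with h1
  · rw [h1]
  · by_contra h2
    exact h1 (expDegree_injective (h j e h2)).symm

/-- The part of degree `d` of an element of the model. -/
def homogeneousPart (d : Fin n →₀ ℕ) (f : edgeSubmodule α β) : edgeSubmodule α β :=
  ⟨monomialTuple d fun j => coeff d (entry j f.1), monomialTuple_mem
    (fun j => (mem_edgeSubmodule_iff.1 f.2 d j).1) (fun j => (mem_edgeSubmodule_iff.1 f.2 d j).2)⟩

lemma homogeneousPart_mem_edgeDeg (d : Fin n →₀ ℕ) (f : edgeSubmodule α β) :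
    homogeneousPart d f ∈ edgeDeg α β (expDegree d) := monomialTuple_mem_edgeDeg _

lemma eq_sum_homogeneousPart (f : edgeSubmodule α β) :
    ∃ D : Finset (Fin n →₀ ℕ), f = ∑ d ∈ D, homogeneousPart d f := by
  refine ⟨Finset.univ.biUnion fun j => (entry j f.1).support,
    Subtype.ext (ext_entry fun j => ?_)⟩
  rw [AddSubmonoidClass.coe_finsetSum, map_sum]
  simp only [homogeneousPart, monomialTuple_apply]
  rw [← Finset.sum_subset (Finset.subset_biUnion_of_mem (fun j => (entry j f.1).support)
    (Finset.mem_univ j))]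
  · exact (entry j f.1).as_sum
  · intro d _ hd
    rw [notMem_support_iff.1 hd, monomial_zero]

lemma edgeDeg_isInternal : DirectSum.IsInternal (edgeDeg α β) := by
  refine DirectSum.isInternal_submodule_of_iSupIndep_of_iSup_eq_top ?_ ?_
  · intro a
    rw [disjoint_iff, eq_bot_iff]
    rintro f ⟨h1, h2⟩
    refine Subtype.ext (ext_entry fun j => ?_)
    ext d
    rw [Submodule.coe_zero, map_zero, coeff_zero]
    by_contra h3
    let L : edgeSubmodule α β →ₗ[k] k :=
      { toFun := fun f => coeff d (entry j f.1)
        map_add' := fun f g => by rw [Submodule.coe_add, map_add, coeff_add]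
        map_smul' := fun c f => by
          rw [Submodule.coe_smul_of_tower, map_smul, coeff_smul, RingHom.id_apply] }
    have h4 : (⨆ b, ⨆ (_ : b ≠ a), edgeDeg α β b) ≤ LinearMap.ker L := by
      refine iSup₂_le fun b hb g hg => ?_
      by_contra h5
      exact hb ((hg j d h5).symm.trans (h1 j d h3))
    exact h3 (h4 h2)
  · rw [eq_top_iff]
    rintro f -
    obtain ⟨D, hD⟩ := eq_sum_homogeneousPart f
    rw [hD]
    exact Submodule.sum_mem _ fun d _ =>
      Submodule.mem_iSup_of_mem (expDegree d) (homogeneousPart_mem_edgeDeg d f)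

lemma edgeSubmodule_finite : Module.Finite (MvPolynomial (Fin n) k) (edgeSubmodule α β) := by
  let L : (Fin n → MvPolynomial (Fin n) k) →ₗ[MvPolynomial (Fin n) k] EdgeFunctions k n :=
    { toFun := fun g => mk fun j => restrictVars (cycEdge j) (g j)
      map_add' := fun f g => ext_entry fun j => map_add (restrictVars (cycEdge j)) _ _
      map_smul' := fun r g => ext_entry fun j => map_mul (restrictVars (cycEdge j)) _ _ }
  have h1 : edgeSubmodule α β ≤ LinearMap.range L := fun f hf =>
    ⟨fun j => entry j f, ext_entry fun j => (hf j).1⟩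
  have h2 : IsNoetherian (MvPolynomial (Fin n) k) (edgeSubmodule α β) :=
    isNoetherian_of_le h1
  exact Module.IsNoetherian.finite _ _

lemma X_smul_monomialTuple (i : Fin n) (d : Fin n →₀ ℕ) (c : Fin n → k) :
    (X i : MvPolynomial (Fin n) k) • monomialTuple d c =
      monomialTuple (d + Finsupp.single i 1) fun j => if i ∈ cycEdge j then c j else 0 := by
  refine ext_entry fun j => ?_
  rw [entry_smul, monomialTuple_apply, monomialTuple_apply, restrictVars_X]
  split_ifs with h
  · rw [X, monomial_mul, one_mul, add_comm]
  · rw [zero_mul, monomial_zero]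

variable (α β) in
/-- The square-free module with structure maps `M_{{j}} → M_{e_j}` and `M_{{j+1}} → M_{e_j}` given
by `α_j` and `β_j`, all of whose compatible families of sections come from degree `0`. -/
def edgeModel : SquareFreeModule k n where
  carrier := edgeSubmodule α β
  finite := edgeSubmodule_finite
  deg := edgeDeg α β
  isInternal := edgeDeg_isInternal
  X_smul_mem a i f hf j d h := by
    change coeff d (restrictVars (cycEdge j) (X i) * entry j f.1) ≠ 0 at h
    rw [restrictVars_X] at h
    split_ifs at h with h1
    · rw [coeff_X_mul'] at h
      split_ifs at h with h2
      · have h3 := hf j _ h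
        rw [← h3, ← expDegree_single, ← expDegree_add, tsub_add_cancel_of_le]
        rw [Finsupp.single_le_iff]
        exact Nat.one_le_iff_ne_zero.2 (Finsupp.mem_support_iff.1 h2)
      · exact absurd rfl h
    · rw [zero_mul] at h
      exact absurd (coeff_zero d) h
  deg_eq_bot a ha := by
    rw [eq_bot_iff]
    intro f hf
    refine Subtype.ext (ext_entry fun j => ?_)
    ext d
    rw [Submodule.coe_zero, map_zero, coeff_zero]
    by_contra h
    exact ha (hf j d h ▸ expDegree_nonneg d)
  bijOn a ha i hi := by
    obtain ⟨d, rfl⟩ := exists_expDegree ha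
    have hid : i ∈ d.support := by
      rw [Finsupp.mem_support_iff]
      simpa [expDegree] using hi
    have hsupp : (d + Finsupp.single i 1).support = d.support := by
      ext l
      by_cases h : i = l
      · subst h; simpa using Finsupp.mem_support_iff.1 hid
      · simp [h]
    rw [← expDegree_single, ← expDegree_add]
    -- multiplication by `x_i` only shifts the exponent
    have key : ∀ c : Fin n → k, (∀ j, ¬ d.support ⊆ cycEdge j → c j = 0) →
        (X i : MvPolynomial (Fin n) k) • monomialTuple d c =
          monomialTuple (d + Finsupp.single i 1) c := by
      intro c hc
      rw [X_smul_monomialTuple]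
      congr 1
      funext j
      split_ifs with h
      · rfl
      · exact (hc j fun h' => h (h' hid)).symm
    have hmem : ∀ (e : Fin n →₀ ℕ) (f : edgeSubmodule α β) (j : Fin n),
        ¬ e.support ⊆ cycEdge j → coeff e (entry j f.1) = 0 := fun e f j =>
      (mem_edgeSubmodule_iff.1 f.2 e j).1
    have key' : ∀ f ∈ edgeDeg α β (expDegree d), (X i : MvPolynomial (Fin n) k) • f.1 =
        monomialTuple (d + Finsupp.single i 1) fun j => coeff d (entry j f.1) := by
      intro f hf
      rw [← key _ (hmem d f), ← eq_monomialTuple_of_mem_edgeDeg hf]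
    refine ⟨fun f hf => ?_, fun f hf g hg hfg => ?_, fun g hg => ?_⟩
    · intro j e he
      have h1 := key' f hf
      change coeff e (entry j ((X i : MvPolynomial (Fin n) k) • f.1)) ≠ 0 at he
      rw [h1, monomialTuple_apply, coeff_monomial] at he
      split_ifs at he with h2
      · rw [h2]
      · exact absurd rfl he
    · have h1 := congrArg Subtype.val hfg
      change (X i : MvPolynomial (Fin n) k) • f.1 = (X i : MvPolynomial (Fin n) k) • g.1 at h1
      rw [key' f hf, key' g hg] at h1
      refine Subtype.ext ?_
      rw [eq_monomialTuple_of_mem_edgeDeg hf, eq_monomialTuple_of_mem_edgeDeg hg]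
      refine ext_entry fun j => ?_
      have h2 := congrArg (entry j) h1
      rw [monomialTuple_apply, monomialTuple_apply] at h2 ⊢
      have h3 := congrArg (coeff (d + Finsupp.single i 1)) h2
      rw [coeff_monomial, coeff_monomial, if_pos rfl, if_pos rfl] at h3
      rw [h3]
    · have h1 : monomialTuple d (fun j => coeff (d + Finsupp.single i 1) (entry j g.1)) ∈
          edgeSubmodule α β := by
        refine monomialTuple_mem (fun j hj => hmem _ g j (hsupp ▸ hj)) fun j hj => ?_
        exact (mem_edgeSubmodule_iff.1 g.2 (d + Finsupp.single i 1) j).2 (hsupp ▸ hj)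
      refine ⟨⟨_, h1⟩, monomialTuple_mem_edgeDeg h1, Subtype.ext ?_⟩
      change (X i : MvPolynomial (Fin n) k) • monomialTuple d _ = g.1
      rw [key _ fun j hj => hmem _ g j (hsupp ▸ hj)]
      exact (eq_monomialTuple_of_mem_edgeDeg hg).symm

end Model

/-! ### Structure maps on vertices and edges -/

namespace SquareFreeModule

variable {k : Type u} [Field k] {n : ℕ}

/-- The structure maps `M_{{j}} → M_{e_j}` and `M_{{j+1}} → M_{e_j}` are `α_j` and `β_j` in the
bases `b` and `c` of the vertex and edge components. -/
structure HasEdgeMaps (M : SquareFreeModule k n) (α β : Fin n → k) (b c : Fin n → M.carrier) :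
    Prop where
  b_mem : ∀ j, b j ∈ M.deg (faceDegree {j})
  b_ne : ∀ j, b j ≠ 0
  c_mem : ∀ j, c j ∈ M.deg (faceDegree (cycEdge j))
  c_ne : ∀ j, c j ≠ 0
  left : ∀ j, (X (cycSucc n j) : MvPolynomial (Fin n) k) • b j = α j • c j
  right : ∀ j, (X j : MvPolynomial (Fin n) k) • b (cycSucc n j) = β j • c j

/-- The components of `M` are those of a rank one module on the `n`-gon: one-dimensional at the
vertices and edges, and zero off the faces. -/
structure IsPolygonal (M : SquareFreeModule k n) : Prop where
  isOver : M.IsOver (polygonBoundary n)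
  rank : M.IsLocallyRankOne (polygonBoundary n)
  multidegree : M.multidegree = 0

lemma exists_smul_eq_of_finrank_eq_one {M : SquareFreeModule k n} {a : Fin n → ℤ}
    (h : Module.finrank k (M.deg a) = 1) {x y : M.carrier} (hx : x ∈ M.deg a) (h0 : x ≠ 0)
    (hy : y ∈ M.deg a) : ∃ r : k, y = r • x := by
  obtain ⟨r, hr⟩ := (finrank_eq_one_iff_of_nonzero' (⟨x, hx⟩ : M.deg a)
    (fun h' => h0 (congrArg Subtype.val h'))).1 h ⟨y, hy⟩
  exact ⟨r, (congrArg Subtype.val hr).symm⟩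

lemma exists_mem_ne_zero_of_finrank_eq_one {M : SquareFreeModule k n} {a : Fin n → ℤ}
    (h : Module.finrank k (M.deg a) = 1) : ∃ x ∈ M.deg a, x ≠ 0 := by
  have : Nontrivial (M.deg a) := Module.nontrivial_of_finrank_pos (R := k) (by rw [h]; simp)
  obtain ⟨x, hx⟩ := exists_ne (0 : M.deg a)
  exact ⟨x, x.2, fun h' => hx (Subtype.ext h')⟩

lemma faceDegree_cycEdge (hn : 3 ≤ n) (j : Fin n) :
    faceDegree (cycEdge j) = Pi.single j 1 + Pi.single (cycSucc n j) 1 := by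
  have h : cycEdge j = insert (cycSucc n j) {j} := Finset.pair_comm _ _
  rw [h, faceDegree_insert (by simpa using cycSucc_ne hn j), faceDegree_singleton]

namespace IsPolygonal

variable {M : SquareFreeModule k n} (hM : M.IsPolygonal) (hn : 3 ≤ n)

include hM in
lemma finrank_vertex (j : Fin n) : Module.finrank k (M.deg (faceDegree {j})) = 1 := by
  have h := congrFun hM.multidegree j
  simp only [SquareFreeModule.multidegree, Pi.zero_apply] at h
  omega

include hM hn in
lemma finrank_edge (j : Fin n) : Module.finrank k (M.deg (faceDegree (cycEdge j))) = 1 :=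
  hM.rank _ (cycEdge_mem hn j) (card_cycEdge hn j)

include hM hn in
lemma exists_hasEdgeMaps : ∃ α β b c, M.HasEdgeMaps α β b c := by
  choose b hb hb0 using fun j => exists_mem_ne_zero_of_finrank_eq_one (hM.finrank_vertex j)
  choose c hc hc0 using fun j => exists_mem_ne_zero_of_finrank_eq_one (hM.finrank_edge hn j)
  have h1 : ∀ j, ∃ r : k, (X (cycSucc n j) : MvPolynomial (Fin n) k) • b j = r • c j := fun j => by
    refine exists_smul_eq_of_finrank_eq_one (hM.finrank_edge hn j) (hc j) (hc0 j) ?_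
    rw [faceDegree_cycEdge hn, ← faceDegree_singleton]
    exact M.X_smul_mem _ _ _ (hb j)
  have h2 : ∀ j, ∃ r : k, (X j : MvPolynomial (Fin n) k) • b (cycSucc n j) = r • c j :=
    fun j => by
      refine exists_smul_eq_of_finrank_eq_one (hM.finrank_edge hn j) (hc j) (hc0 j) ?_
      rw [faceDegree_cycEdge hn, add_comm, ← faceDegree_singleton (cycSucc n j)]
      exact M.X_smul_mem _ _ _ (hb _)
  choose α hα using h1
  choose β hβ using h2
  exact ⟨α, β, b, c, hb, hb0, hc, hc0, hα, hβ⟩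

include hM hn in
lemma two_le_supportDim :
    2 ≤ Module.supportDim (MvPolynomial (Fin n) k) M.carrier := by
  obtain ⟨α, β, b, c, h⟩ := hM.exists_hasEdgeMaps hn
  have h1 := card_le_supportDim (h.c_mem ⟨0, by omega⟩) (h.c_ne _)
  rwa [card_cycEdge hn] at h1

include hM hn in
lemma deg_eq_bot_of_forall {a : Fin n → ℤ} (h : ∀ j : Fin n, ∃ i, i ∉ cycEdge j ∧ a i ≠ 0) :
    M.deg a = ⊥ := by
  refine hM.isOver.deg_eq_bot ?_ fun h' => ?_
  · obtain ⟨i, -, hi⟩ := h ⟨0, by omega⟩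
    exact ⟨i, by simpa using hi⟩
  · obtain ⟨-, j, hj⟩ := (mem_polygonBoundary hn).1 h'
    obtain ⟨i, hi, hi'⟩ := h j
    exact hi (hj (by simpa using hi'))

include hM hn in
lemma X_smul_X_smul_eq_zero {p q : Fin n} (h : ∀ j, ¬ ({p, q} : Finset (Fin n)) ⊆ cycEdge j)
    (m : M.carrier) :
    (X p : MvPolynomial (Fin n) k) • (X q : MvPolynomial (Fin n) k) • m = 0 := by
  have hpq : p ≠ q := by
    rintro rfl
    exact h p (by simp [left_mem_cycEdge])
  have h1 : (∏ i ∈ ({p, q} : Finset (Fin n)), X i : MvPolynomial (Fin n) k) • m = 0 := by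
    refine Module.mem_annihilator.1 (hM.isOver (Ideal.subset_span ⟨_, ?_, fun h' => ?_, rfl⟩)) m
    · simp
    · obtain ⟨-, j, hj⟩ := (mem_polygonBoundary hn).1 h'
      exact h j hj
  rwa [Finset.prod_pair hpq, mul_smul] at h1

variable {α β : Fin n → k} {b c : Fin n → M.carrier} (h : M.HasEdgeMaps α β b c)

include hM hn h in
/-- A homogeneous element becomes a multiple of `c_j` after multiplication by `x_j x_{j+1}`. -/
lemma exists_monomial_smul {d : Fin n →₀ ℕ} {m : M.carrier} (hm : m ∈ M.deg (expDegree d))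
    (j : Fin n) : ∃ r : k, (¬ d.support ⊆ cycEdge j → r = 0) ∧
      (X j * X (cycSucc n j) : MvPolynomial (Fin n) k) • m =
        (monomial d r : MvPolynomial (Fin n) k) • c j := by
  have h1 : (X j * X (cycSucc n j) : MvPolynomial (Fin n) k) • m ∈
      M.deg (faceDegree (cycEdge j) + expDegree d) := by
    rw [mul_comm, mul_smul, faceDegree_cycEdge hn, add_comm, ← add_assoc]
    exact M.X_smul_mem _ _ _ (M.X_smul_mem _ _ _ hm)
  by_cases hd : d.support ⊆ cycEdge j
  · obtain ⟨m', hm', h2⟩ := (bijOn_monomial d (faceDegree_nonneg (cycEdge j)) (fun i hi => by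
      simp [faceDegree, hd (Finsupp.mem_support_iff.2 hi)])).surjOn h1
    obtain ⟨r, rfl⟩ := exists_smul_eq_of_finrank_eq_one (hM.finrank_edge hn j) (h.c_mem j)
      (h.c_ne j) hm'
    refine ⟨r, fun h' => absurd hd h', ?_⟩
    rw [monomial_smul, ← h2]
    exact M.smul_smul_comm r _ _
  · refine ⟨0, fun _ => rfl, ?_⟩
    rw [hM.deg_eq_bot_of_forall hn] at h1
    · rw [monomial_zero, zero_smul]
      exact h1
    · intro l
      by_contra! h2
      have hl : j = l := eq_of_cycEdge_subset hn fun i hi => by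
        by_contra h3
        have h4 := h2 i h3
        simp only [faceDegree, Pi.add_apply, hi, if_true, expDegree] at h4
        omega
      subst hl
      obtain ⟨i, hi, hi'⟩ := Finset.not_subset.1 hd
      have h4 := h2 i hi'
      simp only [faceDegree, Pi.add_apply, hi', if_false, expDegree, zero_add] at h4
      exact Finsupp.mem_support_iff.1 hi (by exact_mod_cast h4)

include hM hn h in
lemma exists_smul_edge (m : M.carrier) (j : Fin n) : ∃ f : MvPolynomial (Fin n) k,
    restrictVars (cycEdge j) f = f ∧
      (X j * X (cycSucc n j) : MvPolynomial (Fin n) k) • m = f • c j := by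
  induction m using M.homogeneous_induction with
  | hom a m hm =>
    by_cases ha : 0 ≤ a
    · obtain ⟨d, rfl⟩ := exists_expDegree ha
      obtain ⟨r, h1, h2⟩ := hM.exists_monomial_smul hn h hm j
      refine ⟨monomial d r, ?_, h2⟩
      rw [restrictVars_monomial]
      split_ifs with hd
      · rfl
      · rw [h1 hd, monomial_zero]
    · rw [M.deg_eq_bot a ha] at hm
      have hm' : m = 0 := hm
      exact ⟨0, map_zero _, by rw [hm', smul_zero, zero_smul]⟩
  | add m m' h1 h2 =>
    obtain ⟨f, hf, hf'⟩ := h1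
    obtain ⟨g, hg, hg'⟩ := h2
    exact ⟨f + g, by rw [map_add, hf, hg], by rw [smul_add, hf', hg', add_smul]⟩

end IsPolygonal

open EdgeFunctions

/-! ### Localization at the edges -/

/-- A linear map to tuples of polynomials which is localization at the edges: its `j`-th entry is
the coordinate of `x_j x_{j+1} m` with respect to `c_j`. -/
def IsEdgeLocalization {M : SquareFreeModule k n} (c : Fin n → M.carrier)
    (L : M.carrier →ₗ[MvPolynomial (Fin n) k] EdgeFunctions k n) : Prop :=
  ∀ m j, restrictVars (cycEdge j) (entry j (L m)) = entry j (L m) ∧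
    (X j * X (cycSucc n j) : MvPolynomial (Fin n) k) • m = entry j (L m) • c j

section Localization

variable {M : SquareFreeModule k n} {α β : Fin n → k} {b c : Fin n → M.carrier}

lemma HasEdgeMaps.coord_unique (h : M.HasEdgeMaps α β b c) {j : Fin n}
    {f g : MvPolynomial (Fin n) k} (hf : restrictVars (cycEdge j) f = f)
    (hg : restrictVars (cycEdge j) g = g) (hfg : f • c j = g • c j) : f = g := by
  have h1 := restrictVars_eq_zero_of_smul_eq_zero (f := f - g) (h.c_mem j) (h.c_ne j)
    (by rw [sub_smul, hfg, sub_self])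
  rwa [map_sub, hf, hg, sub_eq_zero] at h1

/-- On the edge component only the variables of the edge act. -/
lemma IsPolygonal.restrictVars_smul (hM : M.IsPolygonal) (hn : 3 ≤ n)
    (j : Fin n) (r : MvPolynomial (Fin n) k) (m : M.carrier) :
    (restrictVars (cycEdge j) r * (X j * X (cycSucc n j)) : MvPolynomial (Fin n) k) • m =
      (r * (X j * X (cycSucc n j)) : MvPolynomial (Fin n) k) • m := by
  have hX : ∀ i, i ∉ cycEdge j → ∀ m : M.carrier,
      (X i * (X j * X (cycSucc n j)) : MvPolynomial (Fin n) k) • m = 0 := by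
    intro i hi m
    have h1 : (∏ l ∈ insert i (cycEdge j), X l : MvPolynomial (Fin n) k) • m = 0 := by
      refine Module.mem_annihilator.1 (hM.isOver (Ideal.subset_span ⟨_, ?_, fun h' => ?_, rfl⟩)) m
      · simp
      · obtain ⟨-, l, hl⟩ := (mem_polygonBoundary hn).1 h'
        rw [Finset.insert_subset_iff] at hl
        rw [eq_of_cycEdge_subset hn hl.2] at hi
        exact hi hl.1
    rwa [Finset.prod_insert hi, cycEdge, Finset.prod_pair (cycSucc_ne hn j).symm] at h1
  induction r using MvPolynomial.induction_on generalizing m with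
  | C a => rw [← algebraMap_eq, AlgHom.commutes]
  | add p q hp hq => rw [map_add, add_mul, add_smul, hp, hq, add_mul, add_smul]
  | mul_X p i hp =>
    rw [map_mul, restrictVars_X]
    split_ifs with hi
    · rw [mul_right_comm, mul_comm _ (X i), mul_smul, hp, mul_right_comm p, mul_comm _ (X i),
        mul_smul (X i)]
    · rw [mul_zero, zero_mul, zero_smul, mul_assoc, mul_smul, hX i hi, smul_zero]

lemma HasEdgeMaps.exists_localization (h : M.HasEdgeMaps α β b c) (hM : M.IsPolygonal)
    (hn : 3 ≤ n) : ∃ L, M.IsEdgeLocalization c L := by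
  choose F hF hF' using hM.exists_smul_edge hn h
  refine ⟨
    { toFun := fun m => EdgeFunctions.mk (F m)
      map_add' := fun m m' => ext_entry fun j => ?_
      map_smul' := fun r m => ext_entry fun j => ?_ }, fun m j => ⟨hF m j, hF' m j⟩⟩
  · rw [map_add]
    simp only [entry_mk]
    refine h.coord_unique (hF _ j) (by rw [map_add, hF, hF]) ?_
    rw [add_smul, ← hF', ← hF', ← hF', smul_add]
  · rw [RingHom.id_apply, entry_smul]
    simp only [entry_mk]
    refine h.coord_unique (hF _ j) (by rw [map_mul, hF, restrictVars_of_subset subset_rfl]) ?_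
    rw [mul_smul, ← hF', ← hF', smul_smul, smul_smul, hM.restrictVars_smul hn, mul_comm r]

variable {L : M.carrier →ₗ[MvPolynomial (Fin n) k] EdgeFunctions k n}

lemma IsEdgeLocalization.eq_of_smul (hL : M.IsEdgeLocalization c L) (h : M.HasEdgeMaps α β b c)
    {m : M.carrier} {j : Fin n} {f : MvPolynomial (Fin n) k}
    (hf : restrictVars (cycEdge j) f = f)
    (hm : (X j * X (cycSucc n j) : MvPolynomial (Fin n) k) • m = f • c j) :
    entry j (L m) = f :=
  h.coord_unique (hL m j).1 hf ((hL m j).2.symm.trans hm)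

lemma IsEdgeLocalization.exists_monomialTuple (hL : M.IsEdgeLocalization c L)
    (h : M.HasEdgeMaps α β b c) (hM : M.IsPolygonal) (hn : 3 ≤ n) {d : Fin n →₀ ℕ}
    {m : M.carrier} (hm : m ∈ M.deg (expDegree d)) :
    ∃ r : Fin n → k, (∀ j, ¬ d.support ⊆ cycEdge j → r j = 0) ∧ L m = monomialTuple d r := by
  choose r hr hr' using hM.exists_monomial_smul hn h hm
  refine ⟨r, hr, ext_entry fun j => hL.eq_of_smul h ?_ (hr' j)⟩
  rw [monomialTuple_apply, restrictVars_monomial]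
  split_ifs with hd
  · rfl
  · rw [hr j hd, monomial_zero]

lemma restrictVars_X_mul_X (j : Fin n) :
    restrictVars (cycEdge j) (X j * X (cycSucc n j) : MvPolynomial (Fin n) k) =
      X j * X (cycSucc n j) := by
  rw [map_mul, restrictVars_X, restrictVars_X, if_pos (left_mem_cycEdge j),
    if_pos (right_mem_cycEdge j)]

lemma IsEdgeLocalization.entry_c (hL : M.IsEdgeLocalization c L)
    (h : M.HasEdgeMaps α β b c) (hM : M.IsPolygonal) (hn : 3 ≤ n) (l j : Fin n) :
    entry j (L (c l)) = if j = l then X l * X (cycSucc n l) else 0 := by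
  split_ifs with hj
  · subst hj
    exact hL.eq_of_smul h (restrictVars_X_mul_X j) rfl
  · have hd : faceDegree (cycEdge l) =
        expDegree (Finsupp.single l 1 + Finsupp.single (cycSucc n l) 1) := by
      rw [expDegree_add, expDegree_single, expDegree_single, faceDegree_cycEdge hn]
    obtain ⟨r, hr, hr'⟩ := hL.exists_monomialTuple h hM hn (hd ▸ h.c_mem l)
    rw [hr', monomialTuple_apply, hr j, monomial_zero]
    intro hs
    refine hj (eq_of_cycEdge_subset hn fun i hi => hs ?_).symm
    rcases mem_cycEdge.1 hi with rfl | rfl <;> simp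

lemma IsEdgeLocalization.entry_b (hL : M.IsEdgeLocalization c L)
    (h : M.HasEdgeMaps α β b c) (hM : M.IsPolygonal) (hn : 3 ≤ n) (l j : Fin n) :
    entry j (L (b (cycSucc n l))) =
      if j = l then β l • X (cycSucc n l) else
        if j = cycSucc n l then α (cycSucc n l) • X (cycSucc n l) else 0 := by
  split_ifs with h1 h2
  · subst h1
    refine hL.eq_of_smul h (by rw [map_smul, restrictVars_X, if_pos (right_mem_cycEdge j)]) ?_
    rw [mul_comm, mul_smul, h.right, smul_smul_comm, smul_assoc]
  · subst h2
    refine hL.eq_of_smul h (by rw [map_smul, restrictVars_X, if_pos (left_mem_cycEdge _)]) ?_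
    rw [mul_smul, h.left, smul_smul_comm, smul_assoc]
  · have hd : faceDegree {cycSucc n l} = expDegree (Finsupp.single (cycSucc n l) 1) := by
      rw [expDegree_single, faceDegree_singleton]
    obtain ⟨r, hr, hr'⟩ := hL.exists_monomialTuple h hM hn (hd ▸ h.b_mem (cycSucc n l))
    rw [hr', monomialTuple_apply, hr j, monomial_zero]
    intro hs
    have hs' : cycSucc n l ∈ cycEdge j := hs (by simp)
    rcases cycSucc_mem_cycEdge.1 hs' with h3 | h3
    · exact h1 h3
    · exact h2 h3

/-- Localization at the edges takes values in the model. -/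
lemma IsEdgeLocalization.mem_edgeSubmodule (hL : M.IsEdgeLocalization c L)
    (h : M.HasEdgeMaps α β b c) (hM : M.IsPolygonal) (hn : 3 ≤ n) (m : M.carrier) :
    L m ∈ edgeSubmodule α β := by
  induction m using M.homogeneous_induction with
  | add m m' h1 h2 => rw [map_add]; exact add_mem h1 h2
  | hom a m hm =>
    by_cases ha : 0 ≤ a
    swap
    · rw [M.deg_eq_bot a ha] at hm
      rw [show m = 0 from hm, map_zero]
      exact zero_mem _
    obtain ⟨d, rfl⟩ := exists_expDegree ha
    obtain ⟨r, hr, hr'⟩ := hL.exists_monomialTuple h hM hn hm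
    rw [hr']
    refine monomialTuple_mem hr fun l hl => ?_
    -- `x_{l+1} m` is a multiple of the basis element at the vertex `l + 1`
    have h1 : (X (cycSucc n l) : MvPolynomial (Fin n) k) • m ∈
        M.deg (faceDegree {cycSucc n l} + expDegree d) := by
      rw [add_comm, faceDegree_singleton]
      exact M.X_smul_mem _ _ _ hm
    obtain ⟨m', hm', h2⟩ := (bijOn_monomial d (faceDegree_nonneg {cycSucc n l}) (fun i hi => by
      have := hl (Finsupp.mem_support_iff.2 hi)
      simp [faceDegree, Finset.mem_singleton.1 this])).surjOn h1
    obtain ⟨t, rfl⟩ := exists_smul_eq_of_finrank_eq_one (hM.finrank_vertex (cycSucc n l))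
      (h.b_mem _) (h.b_ne _) hm'
    have h3 : ∀ j, cycSucc n l ∈ cycEdge j → ∀ s : k,
        entry j (L (b (cycSucc n l))) = s • X (cycSucc n l) → r j = s * t := by
      intro j hj s hs
      have hdj : d.support ⊆ cycEdge j := hl.trans (by simpa using hj)
      have h4 := congrArg (fun m => coeff (d + Finsupp.single (cycSucc n l) 1) (entry j (L m))) h2
      simp only [map_smul, entry_smul, hr', monomialTuple_apply, restrictVars_X, if_pos hj] at h4
      rw [← C_smul, map_smul, entry_smul, hs, ← algebraMap_eq, AlgHom.commutes, algebraMap_eq,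
        restrictVars_monomial, if_pos hdj, X, smul_monomial, monomial_mul, C_mul_monomial,
        monomial_mul] at h4
      rw [coeff_monomial, coeff_monomial, if_pos rfl, if_pos (add_comm _ _)] at h4
      simp only [smul_eq_mul, mul_one, one_mul] at h4
      rw [← h4, mul_comm]
    rw [h3 l (right_mem_cycEdge l) (β l) (by rw [hL.entry_b h hM hn, if_pos rfl]),
      h3 (cycSucc n l) (left_mem_cycEdge _) (α (cycSucc n l))
        (by rw [hL.entry_b h hM hn, if_neg (cycSucc_ne hn l), if_pos rfl])]
    ring

section Depth

variable (h0 : ∀ m : M.carrier, (∀ i, (X i : MvPolynomial (Fin n) k) • m = 0) → m = 0)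
  (hK : ∀ m : Fin n → M.carrier, (∀ i j, (X j : MvPolynomial (Fin n) k) • m i =
      (X i : MvPolynomial (Fin n) k) • m j) →
    ∃ w, ∀ i, (X i : MvPolynomial (Fin n) k) • w = m i)

include h0 hK in
/-- In depth two, localization at the edges is injective. -/
lemma IsEdgeLocalization.injective (hL : M.IsEdgeLocalization c L)
    (hM : M.IsPolygonal) (hn : 3 ≤ n) :
    Function.Injective L := by
  rw [injective_iff_map_eq_zero]
  intro m hm
  have h1 : ∀ j, (X j : MvPolynomial (Fin n) k) •
      (X (cycSucc n j) : MvPolynomial (Fin n) k) • m = 0 := by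
    intro j
    rw [← mul_smul, (hL m j).2, hm, map_zero, zero_smul]
  refine eq_zero_of_X_smul_X_smul_eq_zero h0 hK fun p q hpq => ?_
  by_cases h2 : ∃ j, ({p, q} : Finset (Fin n)) ⊆ cycEdge j
  · obtain ⟨j, hj⟩ := h2
    rcases mem_cycEdge.1 (hj (Finset.mem_insert_self p _)) with rfl | rfl <;>
    rcases mem_cycEdge.1 (hj (Finset.mem_insert_of_mem (Finset.mem_singleton_self q))) with
      rfl | rfl
    · exact absurd rfl hpq
    · exact h1 _
    · rw [smul_comm]; exact h1 _
    · exact absurd rfl hpq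
  · exact hM.X_smul_X_smul_eq_zero hn (fun j hj => h2 ⟨j, hj⟩) m

include h0 hK in
/-- In depth two, the two structure maps at a vertex do not both vanish. -/
lemma HasEdgeMaps.vertex_ne_zero (h : M.HasEdgeMaps α β b c)
    (hM : M.IsPolygonal) (hn : 3 ≤ n) (l : Fin n) : α (cycSucc n l) ≠ 0 ∨ β l ≠ 0 := by
  obtain ⟨L, hL⟩ := h.exists_localization hM hn
  by_contra! h1
  refine h.b_ne (cycSucc n l) (hL.injective h0 hK hM hn (ext_entry fun j => ?_))
  rw [hL.entry_b h hM hn, h1.1, h1.2, zero_smul, map_zero, map_zero, ite_self, ite_self]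

include h0 hK in
/-- In depth two, localization at the edges has the model as its image. -/
lemma IsEdgeLocalization.exists_eq (hL : M.IsEdgeLocalization c L)
    (h : M.HasEdgeMaps α β b c) (hM : M.IsPolygonal) (hn : 3 ≤ n) {g : EdgeFunctions k n}
    (hg : g ∈ edgeSubmodule α β) : ∃ m, L m = g := by
  have hinj := hL.injective h0 hK hM hn
  have h1 : ∀ v, ∃ m, L m = (X v : MvPolynomial (Fin n) k) • g := by
    intro v
    obtain ⟨l, rfl⟩ := (cycSucc n).surjective v
    have hsub1 : ({cycSucc n l} : Finset (Fin n)) ⊆ cycEdge l := by simp [right_mem_cycEdge]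
    have hsub2 : ({cycSucc n l} : Finset (Fin n)) ⊆ cycEdge (cycSucc n l) := by
      simp [left_mem_cycEdge]
    -- the restrictions to the axis of `x_{l+1}` are the multiples `β_l f` and `α_{l+1} f`
    obtain ⟨f, hf, hf1, hf2⟩ : ∃ f : MvPolynomial (Fin n) k,
        restrictVars {cycSucc n l} f = f ∧
        restrictVars {cycSucc n l} (entry l g) = β l • f ∧
        restrictVars {cycSucc n l} (entry (cycSucc n l) g) = α (cycSucc n l) • f := by
      have h2 := (hg l).2
      rcases h.vertex_ne_zero h0 hK hM hn l with h3 | h3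
      · refine ⟨(α (cycSucc n l))⁻¹ • restrictVars {cycSucc n l} (entry (cycSucc n l) g),
          ?_, ?_, ?_⟩
        · rw [map_smul, restrictVars_of_subset subset_rfl]
        · rw [smul_comm, ← h2, inv_smul_smul₀ h3]
        · rw [smul_inv_smul₀ h3]
      · refine ⟨(β l)⁻¹ • restrictVars {cycSucc n l} (entry l g), ?_, ?_, ?_⟩
        · rw [map_smul, restrictVars_of_subset subset_rfl]
        · rw [smul_inv_smul₀ h3]
        · rw [smul_comm, h2, inv_smul_smul₀ h3]
    obtain ⟨p, hp⟩ : X l ∣ entry l g - β l • f := by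
      refine X_dvd_of_restrictVars_eq_zero (F := cycEdge l) (G := {cycSucc n l}) ?_ ?_ ?_
      · rw [← hf1, map_sub, (hg l).1, restrictVars_restrictVars, Finset.inter_eq_right.2 hsub1]
      · intro i hi hil
        rcases mem_cycEdge.1 hi with rfl | rfl
        · exact absurd rfl hil
        · simp
      · rw [map_sub, map_smul, hf, hf1, sub_self]
    obtain ⟨q, hq⟩ : X (cycSucc n (cycSucc n l)) ∣
        entry (cycSucc n l) g - α (cycSucc n l) • f := by
      refine X_dvd_of_restrictVars_eq_zero (F := cycEdge (cycSucc n l)) (G := {cycSucc n l})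
        ?_ ?_ ?_
      · rw [← hf2, map_sub, (hg _).1, restrictVars_restrictVars, Finset.inter_eq_right.2 hsub2]
      · intro i hi hil
        rcases mem_cycEdge.1 hi with rfl | rfl
        · simp
        · exact absurd rfl hil
      · rw [map_sub, map_smul, hf, hf2, sub_self]
    have hfe : ∀ F : Finset (Fin n), {cycSucc n l} ⊆ F → restrictVars F f = f := by
      intro F hF
      conv_lhs => rw [← hf]
      rw [restrictVars_restrictVars, Finset.inter_eq_right.2 hF, hf]
    have hp' : entry l g = β l • f + X l * restrictVars (cycEdge l) p := by
      have h4 := congrArg (restrictVars (cycEdge l)) hp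
      rw [map_sub, (hg l).1, map_smul, hfe _ hsub1, map_mul, restrictVars_X,
        if_pos (left_mem_cycEdge l)] at h4
      rw [← h4]; ring
    have hq' : entry (cycSucc n l) g = α (cycSucc n l) • f +
        X (cycSucc n (cycSucc n l)) * restrictVars (cycEdge (cycSucc n l)) q := by
      have h4 := congrArg (restrictVars (cycEdge (cycSucc n l))) hq
      rw [map_sub, (hg _).1, map_smul, hfe _ hsub2, map_mul, restrictVars_X,
        if_pos (right_mem_cycEdge _)] at h4
      rw [← h4]; ring
    refine ⟨f • b (cycSucc n l) + p • c l + q • c (cycSucc n l), ext_entry fun j => ?_⟩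
    simp only [map_add, map_smul, entry_smul, hL.entry_b h hM hn, hL.entry_c h hM hn,
      restrictVars_X]
    by_cases hj : j = l
    · subst hj
      rw [if_pos rfl, if_pos rfl, if_neg (cycSucc_ne hn j).symm, if_pos (right_mem_cycEdge j),
        hp', hfe _ hsub1, mul_zero, add_zero, mul_smul_comm, mul_add, mul_smul_comm]
      rw [mul_comm f]; ring
    · by_cases hj' : j = cycSucc n l
      · subst hj'
        rw [if_neg hj, if_pos rfl, if_neg hj, if_pos rfl, if_pos (left_mem_cycEdge _),
          hq', hfe _ hsub2, mul_zero, add_zero, mul_smul_comm, mul_add, mul_smul_comm]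
        rw [mul_comm f]; ring
      · have hj2 : cycSucc n l ∉ cycEdge j := fun h' => by
          rcases cycSucc_mem_cycEdge.1 h' with h' | h'
          · exact hj h'
          · exact hj' h'
        simp [hj, hj', hj2]
  choose m hm using h1
  obtain ⟨w, hw⟩ := hK m fun i j => hinj (by rw [map_smul, map_smul, hm, hm, smul_comm])
  refine ⟨w, ext_entry fun j => ?_⟩
  have h2 := congrArg (entry j) (hm j)
  rw [← hw j, map_smul, entry_smul, entry_smul, restrictVars_X, if_pos (left_mem_cycEdge j)] at h2
  exact mul_left_cancel₀ (X_ne_zero j) h2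

end Depth

lemma Iso.of_forall_mem {M N : SquareFreeModule k n}
    (f : M.carrier ≃ₗ[MvPolynomial (Fin n) k] N.carrier)
    (hf : ∀ a m, m ∈ M.deg a → f m ∈ N.deg a) : M.Iso N := by
  refine ⟨f, fun a m => ⟨hf a m, fun h => ?_⟩⟩
  have hcomp : ∀ a m, N.comp a (f m) = f (M.comp a m) := by
    intro a m
    induction m using M.homogeneous_induction with
    | hom b m hm =>
      by_cases hab : a = b
      · subst hab
        rw [comp_of_mem hm, comp_of_mem (hf a m hm)]
      · rw [comp_of_mem_ne hab hm, comp_of_mem_ne hab (hf b m hm), map_zero]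
    | add m m' h h' => simp only [map_add, h, h']
  have h1 := hcomp a m
  rw [comp_of_mem h] at h1
  rw [f.injective h1]
  exact M.comp_mem a m

/-- A Cohen–Macaulay module of the family is determined by its structure maps: it is isomorphic to
the model with these maps. -/
theorem HasEdgeMaps.iso_edgeModel (h : M.HasEdgeMaps α β b c) (hM : M.IsPolygonal) (hn : 3 ≤ n)
    (hCM : M.IsCM) : M.Iso (edgeModel α β) := by
  obtain ⟨h0, hK⟩ := hCM.koszul (hM.two_le_supportDim hn)
  obtain ⟨L, hL⟩ := h.exists_localization hM hn
  have hinj := hL.injective h0 hK hM hn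
  let L' : M.carrier →ₗ[MvPolynomial (Fin n) k] edgeSubmodule α β :=
    L.codRestrict _ (hL.mem_edgeSubmodule h hM hn)
  have hbij : Function.Bijective L' := by
    refine ⟨fun m m' hm => hinj (congrArg Subtype.val hm), fun g => ?_⟩
    obtain ⟨m, hm⟩ := hL.exists_eq h0 hK h hM hn g.2
    exact ⟨m, Subtype.ext hm⟩
  refine Iso.of_forall_mem (N := edgeModel α β) (LinearEquiv.ofBijective L' hbij)
    fun a m hm => ?_
  by_cases ha : 0 ≤ a
  · obtain ⟨d, rfl⟩ := exists_expDegree ha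
    obtain ⟨r, hr, hr'⟩ := hL.exists_monomialTuple h hM hn hm
    have h1 : L' m = ⟨monomialTuple d r, hr' ▸ hL.mem_edgeSubmodule h hM hn m⟩ := Subtype.ext hr'
    change L' m ∈ edgeDeg α β _
    rw [h1]
    exact monomialTuple_mem_edgeDeg _
  · rw [M.deg_eq_bot a ha] at hm
    obtain rfl : m = 0 := hm
    change L' 0 ∈ edgeDeg α β a
    rw [map_zero]
    exact zero_mem _

end Localization

end SquareFreeModule

/-! ### Properties of the models -/

section ModelProperties

open EdgeFunctions SquareFreeModule
open scoped Pointwise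

variable {k : Type u} [Field k] {n : ℕ} {α β : Fin n → k}

variable (α β) in
/-- The coefficients, at the edges, of the basis element of the model at the vertex `v`. -/
def vertexCoeff (v j : Fin n) : k :=
  if j = v then α v else if cycSucc n j = v then β j else 0

lemma vertexTuple_mem (hn : 3 ≤ n) (v : Fin n) :
    monomialTuple (Finsupp.single v 1) (vertexCoeff α β v) ∈ edgeSubmodule α β := by
  refine monomialTuple_mem (fun j hj => ?_) fun j hj => ?_
  · rw [vertexCoeff, if_neg, if_neg]
    · rintro rfl
      exact hj (by simp [right_mem_cycEdge])
    · rintro rfl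
      exact hj (by simp [left_mem_cycEdge])
  · obtain rfl : v = cycSucc n j := by
      have hv : v ∈ ({cycSucc n j} : Finset (Fin n)) := hj (by simp)
      simpa using hv
    rw [vertexCoeff, if_neg (cycSucc_ne hn j).symm, if_pos rfl, vertexCoeff, if_pos rfl, mul_comm]

/-- The exponent vector of `x_l x_{l+1}`. -/
def edgeExp (l : Fin n) : Fin n →₀ ℕ := Finsupp.single l 1 + Finsupp.single (cycSucc n l) 1

lemma support_edgeExp (l : Fin n) : (edgeExp l).support = cycEdge l := by
  ext i
  rw [Finsupp.mem_support_iff, mem_cycEdge, edgeExp, Finsupp.add_apply, Finsupp.single_apply,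
    Finsupp.single_apply, eq_comm (a := i), eq_comm (a := i)]
  split_ifs with h1 h2 h2 <;> simp [h1, h2]

lemma expDegree_edgeExp (hn : 3 ≤ n) (l : Fin n) :
    expDegree (edgeExp l) = faceDegree (cycEdge l) := by
  rw [edgeExp, expDegree_add, expDegree_single, expDegree_single, faceDegree_cycEdge hn]

lemma edgeTuple_mem (hn : 3 ≤ n) (l : Fin n) :
    monomialTuple (edgeExp l) (Pi.single l 1) ∈ edgeSubmodule α β := by
  refine monomialTuple_mem (fun j hj => ?_) fun j hj => ?_
  · rw [support_edgeExp] at hj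
    refine Pi.single_eq_of_ne ?_ _
    rintro rfl
    exact hj subset_rfl
  · rw [support_edgeExp] at hj
    have := Finset.card_le_card hj
    rw [card_cycEdge hn, Finset.card_singleton] at this
    omega

variable (α β) in
/-- The basis elements of the model at the vertices. -/
def modelVertex (hn : 3 ≤ n) (v : Fin n) : (edgeModel α β).carrier :=
  (⟨_, vertexTuple_mem hn v⟩ : edgeSubmodule α β)

variable (α β) in
/-- The basis elements of the model at the edges. -/
def modelEdge (hn : 3 ≤ n) (l : Fin n) : (edgeModel α β).carrier :=
  (⟨_, edgeTuple_mem hn l⟩ : edgeSubmodule α β)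

/-- The condition at the vertices ensures that the basis elements there are nonzero. -/
lemma edgeModel_hasEdgeMaps (hn : 3 ≤ n) (hv : ∀ l, α (cycSucc n l) ≠ 0 ∨ β l ≠ 0) :
    (edgeModel α β).HasEdgeMaps α β (modelVertex α β hn) (modelEdge α β hn) where
  b_mem v := by
    have h := monomialTuple_mem_edgeDeg (vertexTuple_mem (α := α) (β := β) hn v)
    rw [expDegree_single, ← faceDegree_singleton] at h
    exact h
  b_ne v h := by
    obtain ⟨l, rfl⟩ := (cycSucc n).surjective v
    have h1 : ∀ j, vertexCoeff α β (cycSucc n l) j = 0 := fun j => by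
      have h2 := congrArg (fun f : edgeSubmodule α β =>
        coeff (Finsupp.single (cycSucc n l) 1) (entry j f.1)) h
      change coeff _ (entry j (monomialTuple _ _)) = coeff _ (entry j 0) at h2
      rw [monomialTuple_apply, coeff_monomial, if_pos rfl, map_zero, coeff_zero] at h2
      exact h2
    rcases hv l with h2 | h2
    · have := h1 (cycSucc n l)
      rw [vertexCoeff, if_pos rfl] at this
      exact h2 this
    · have := h1 l
      rw [vertexCoeff, if_neg (cycSucc_ne hn l).symm, if_pos rfl] at this
      exact h2 this
  c_mem l := by
    have h := monomialTuple_mem_edgeDeg (edgeTuple_mem (α := α) (β := β) hn l)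
    rw [expDegree_edgeExp hn] at h
    exact h
  c_ne l h := by
    have h2 := congrArg (fun f : edgeSubmodule α β => coeff (edgeExp l) (entry l f.1)) h
    change coeff _ (entry l (monomialTuple _ _)) = coeff _ (entry l 0) at h2
    rw [monomialTuple_apply, coeff_monomial, if_pos rfl, map_zero, coeff_zero,
      Pi.single_eq_same] at h2
    exact one_ne_zero h2
  left j := by
    refine Subtype.ext (ext_entry fun l => ?_)
    change entry l ((X (cycSucc n j) : MvPolynomial (Fin n) k) • monomialTuple _ _) =
      entry l (α j • monomialTuple _ _)
    rw [X_smul_monomialTuple, map_smul, monomialTuple_apply, monomialTuple_apply, smul_monomial]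
    congr 1
    simp only [cycSucc_mem_cycEdge]
    by_cases h : l = j
    · subst h
      simp [vertexCoeff]
    · by_cases h' : l = cycSucc n j
      · subst h'
        simp [vertexCoeff, cycSucc_ne hn, cycSucc_cycSucc_ne hn]
      · simp [h, h']
  right j := by
    refine Subtype.ext (ext_entry fun l => ?_)
    change entry l ((X j : MvPolynomial (Fin n) k) • monomialTuple _ _) =
      entry l (β j • monomialTuple _ _)
    rw [X_smul_monomialTuple, map_smul, monomialTuple_apply, monomialTuple_apply, smul_monomial,
      edgeExp, add_comm (Finsupp.single j 1)]
    congr 1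
    by_cases h : l = j
    · subst h
      simp [vertexCoeff, left_mem_cycEdge, (cycSucc_ne hn l).symm]
    · by_cases h' : l = cycSucc n j
      · subst h'
        have : j ∉ cycEdge (cycSucc n j) := by
          simp [mem_cycEdge, (cycSucc_ne hn j).symm, (cycSucc_cycSucc_ne hn j).symm]
        simp [this, cycSucc_ne hn]
      · simp [vertexCoeff, h, h']

lemma edgeModel_isOver (hn : 3 ≤ n) : (edgeModel α β).IsOver (polygonBoundary n) := by
  refine Ideal.span_le.2 ?_
  rintro f ⟨σ, hσ, hσ', rfl⟩
  refine Module.mem_annihilator.2 fun (m : edgeSubmodule α β) =>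
    Subtype.ext (ext_entry fun j => ?_)
  change restrictVars (cycEdge j) (∏ i ∈ σ, X i) * entry j m.1 = entry j 0
  obtain ⟨i, hi, hi'⟩ := Finset.not_subset.1 fun h =>
    hσ' ((mem_polygonBoundary hn).2 ⟨hσ, j, h⟩)
  rw [map_prod, Finset.prod_eq_zero hi, zero_mul, map_zero]
  rw [restrictVars_X, if_neg hi']

lemma edgeModel_isPolygonal (hn : 3 ≤ n) (hv : ∀ l, α (cycSucc n l) ≠ 0 ∨ β l ≠ 0) :
    (edgeModel α β).IsPolygonal where
  isOver := edgeModel_isOver hn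
  rank F hF hF' := by
    obtain ⟨l, rfl⟩ := eq_cycEdge_of_mem hn hF hF'
    have h := edgeModel_hasEdgeMaps hn hv
    refine finrank_eq_one (⟨_, h.c_mem l⟩ : (edgeModel α β).deg (faceDegree (cycEdge l)))
      (fun h' => h.c_ne l (congrArg Subtype.val h')) ?_
    rintro ⟨(f : edgeSubmodule α β), hf⟩
    refine ⟨coeff (edgeExp l) (entry l f.1), Subtype.ext (Subtype.ext ?_)⟩
    change (_ : k) • monomialTuple _ _ = f.1
    rw [← expDegree_edgeExp hn] at hf
    refine Eq.trans (ext_entry fun j => ?_) (eq_monomialTuple_of_mem_edgeDeg hf).symm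
    rw [map_smul, monomialTuple_apply, monomialTuple_apply, smul_monomial]
    congr 1
    by_cases hj : j = l
    · subst hj
      simp
    · rw [Pi.single_eq_of_ne hj, smul_zero]
      refine ((mem_edgeSubmodule_iff.1 f.2 _ j).1 fun h' => hj ?_).symm
      rw [support_edgeExp] at h'
      exact (eq_of_cycEdge_subset hn h').symm
  multidegree := by
    funext v
    suffices Module.finrank k ((edgeModel α β).deg (faceDegree {v})) = 1 by
      simp [SquareFreeModule.multidegree, this]
    have h := edgeModel_hasEdgeMaps hn hv
    refine finrank_eq_one (⟨_, h.b_mem v⟩ : (edgeModel α β).deg (faceDegree {v}))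
      (fun h' => h.b_ne v (congrArg Subtype.val h')) ?_
    rintro ⟨(f : edgeSubmodule α β), hf⟩
    obtain ⟨l, rfl⟩ := (cycSucc n).surjective v
    set d : Fin n →₀ ℕ := Finsupp.single (cycSucc n l) 1 with hd
    have hds : d.support = {cycSucc n l} := by simp [hd]
    have hrel := (mem_edgeSubmodule_iff.1 f.2 d l).2 hds.subset
    obtain ⟨t, ht1, ht2⟩ : ∃ t : k, coeff d (entry l f.1) = t * β l ∧
        coeff d (entry (cycSucc n l) f.1) = t * α (cycSucc n l) := by
      rcases hv l with h2 | h2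
      · refine ⟨coeff d (entry (cycSucc n l) f.1) / α (cycSucc n l), ?_, ?_⟩
        · field_simp
          rw [mul_comm, hrel, mul_comm]
        · field_simp
      · refine ⟨coeff d (entry l f.1) / β l, ?_, ?_⟩
        · field_simp
        · field_simp
          rw [mul_comm, ← hrel, mul_comm]
    refine ⟨t, Subtype.ext (Subtype.ext ?_)⟩
    change (_ : k) • monomialTuple _ _ = f.1
    rw [faceDegree_singleton, ← expDegree_single, ← hd] at hf
    refine Eq.trans (ext_entry fun j => ?_) (eq_monomialTuple_of_mem_edgeDeg hf).symm
    rw [map_smul, monomialTuple_apply, monomialTuple_apply, smul_monomial, ← hd]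
    congr 1
    by_cases hj : j = l
    · subst hj
      rw [ht1, vertexCoeff, if_neg (cycSucc_ne hn j).symm, if_pos rfl, smul_eq_mul]
    · by_cases hj' : j = cycSucc n l
      · subst hj'
        rw [ht2, vertexCoeff, if_pos rfl, smul_eq_mul]
      · rw [vertexCoeff, if_neg hj', if_neg (fun h' => hj ((cycSucc n).injective h')), smul_zero]
        refine ((mem_edgeSubmodule_iff.1 f.2 _ j).1 fun h' => ?_).symm
        rw [hds, Finset.singleton_subset_iff, cycSucc_mem_cycEdge] at h'
        exact h'.elim hj hj'

/-! ### Cohen–Macaulayness of the models -/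

variable (k n) in
/-- The quadratic parameter `∑ x_j x_{j+1}`. -/
def quadraticParam : MvPolynomial (Fin n) k := ∑ j, X j * X (cycSucc n j)

variable (k n) in
/-- The linear parameter `∑ x_j`. -/
def linearParam : MvPolynomial (Fin n) k := ∑ j, X j

lemma restrictVars_quadraticParam (hn : 3 ≤ n) (j : Fin n) :
    restrictVars (cycEdge j) (quadraticParam k n) = X j * X (cycSucc n j) := by
  rw [quadraticParam, map_sum, Finset.sum_eq_single j]
  · exact restrictVars_X_mul_X j
  · intro l _ hl
    rw [map_mul, restrictVars_X, restrictVars_X]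
    split_ifs with h1 h2
    · refine absurd (eq_of_cycEdge_subset hn fun i hi => ?_) hl
      rcases mem_cycEdge.1 hi with rfl | rfl
      · exact h1
      · exact h2
    all_goals simp
  · simp

lemma restrictVars_linearParam (hn : 3 ≤ n) (j : Fin n) :
    restrictVars (cycEdge j) (linearParam k n) = X j + X (cycSucc n j) := by
  rw [linearParam, map_sum]
  simp only [restrictVars_X]
  rw [← Finset.sum_filter]
  have : Finset.univ.filter (fun i => i ∈ cycEdge j) = cycEdge j := by ext; simp
  rw [this, cycEdge, Finset.sum_pair (cycSucc_ne hn j).symm]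

lemma not_X_dvd_X_add_X {p q : Fin n} (hpq : p ≠ q) :
    ¬ (X p : MvPolynomial (Fin n) k) ∣ X p + X q := by
  rw [dvd_add_right dvd_rfl, X_dvd_X]
  exact hpq

lemma exists_mul_X_mul_X {p q : Fin n} (hpq : p ≠ q) {u w : MvPolynomial (Fin n) k}
    (h : (X p + X q) * u = X p * X q * w) :
    ∃ f, u = X p * X q * f ∧ w = (X p + X q) * f := by
  obtain ⟨u', rfl⟩ := (X_prime.dvd_or_dvd (⟨X q * w, by rw [h, mul_assoc]⟩ :
    (X p : MvPolynomial (Fin n) k) ∣ (X p + X q) * u)).resolve_left (not_X_dvd_X_add_X hpq)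
  have h1 : (X p + X q) * u' = X q * w := by
    refine mul_left_cancel₀ (X_ne_zero p) ?_
    rw [← mul_assoc (X p) (X q), ← h]; ring
  obtain ⟨f, rfl⟩ := (X_prime.dvd_or_dvd (⟨w, h1⟩ :
    (X q : MvPolynomial (Fin n) k) ∣ (X p + X q) * u')).resolve_left (by
      rw [add_comm]; exact not_X_dvd_X_add_X hpq.symm)
  refine ⟨f, by ring, ?_⟩
  refine mul_left_cancel₀ (X_ne_zero q) ?_
  rw [← h1]; ring

lemma quadraticParam_smul_eq_zero (hn : 3 ≤ n) {u : edgeSubmodule α β}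
    (h : quadraticParam k n • u = 0) : u = 0 := by
  refine Subtype.ext (ext_entry fun j => ?_)
  have h1 : entry j (quadraticParam k n • u.1) = entry j 0 :=
    congrArg (fun f : edgeSubmodule α β => entry j f.1) h
  rw [entry_smul, restrictVars_quadraticParam hn, map_zero] at h1
  rw [ZeroMemClass.coe_zero, map_zero]
  exact (mul_eq_zero.1 h1).resolve_left (mul_ne_zero (X_ne_zero _) (X_ne_zero _))

/-- `∑ x_j` is regular modulo `∑ x_j x_{j+1}`: the quotient polynomials on the edges satisfy the
condition at a vertex because `∑ x_j` restricts to a nonzerodivisor on its axis. -/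
lemma exists_quadraticParam_smul (hn : 3 ≤ n) {u w : edgeSubmodule α β}
    (h : linearParam k n • u = quadraticParam k n • w) :
    ∃ f : edgeSubmodule α β, u = quadraticParam k n • f := by
  have h1 : ∀ j, ∃ f, restrictVars (cycEdge j) f = f ∧
      entry j u.1 = X j * X (cycSucc n j) * f ∧ entry j w.1 = (X j + X (cycSucc n j)) * f := by
    intro j
    have h2 : entry j (linearParam k n • u.1) = entry j (quadraticParam k n • w.1) :=
      congrArg (fun f : edgeSubmodule α β => entry j f.1) h
    rw [entry_smul, entry_smul, restrictVars_linearParam hn, restrictVars_quadraticParam hn] at h2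
    obtain ⟨f, hu, hw⟩ := exists_mul_X_mul_X (cycSucc_ne hn j).symm h2
    refine ⟨restrictVars (cycEdge j) f, restrictVars_of_subset subset_rfl f, ?_, ?_⟩
    · rw [← (u.2 j).1, hu, map_mul, restrictVars_X_mul_X]
    · rw [← (w.2 j).1, hw, map_mul, map_add, restrictVars_X, restrictVars_X,
        if_pos (left_mem_cycEdge j), if_pos (right_mem_cycEdge j)]
  choose f hf hu hw using h1
  have hmem : EdgeFunctions.mk f ∈ edgeSubmodule α β := by
    intro j
    refine ⟨hf j, mul_left_cancel₀ (X_ne_zero (cycSucc n j)) ?_⟩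
    have h2 := (w.2 j).2
    rw [hw, hw, map_mul, map_mul, map_add, map_add] at h2
    simp only [restrictVars_X, Finset.mem_singleton, if_true, (cycSucc_ne hn j).symm,
      cycSucc_ne hn (cycSucc n j), if_false, zero_add, add_zero] at h2
    rw [mul_smul_comm, mul_smul_comm]
    exact h2
  refine ⟨⟨_, hmem⟩, Subtype.ext (ext_entry fun j => ?_)⟩
  change _ = restrictVars (cycEdge j) (quadraticParam k n) * f j
  rw [restrictVars_quadraticParam hn, hu]

lemma edgeModel_isCM (hn : 3 ≤ n) (hv : ∀ l, α (cycSucc n l) ≠ 0 ∨ β l ≠ 0) :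
    (edgeModel α β).IsCM := by
  have hX : ∀ i, (X i : MvPolynomial (Fin n) k) ∈ idealOfVars (Fin n) k := fun i =>
    Ideal.subset_span ⟨i, rfl⟩
  have hrs : ∀ r ∈ [quadraticParam k n, linearParam k n], r ∈ idealOfVars (Fin n) k := by
    intro r hr
    simp only [List.mem_cons, List.not_mem_nil, or_false] at hr
    rcases hr with rfl | rfl
    · exact Ideal.sum_mem _ fun j _ => Ideal.mul_mem_right _ _ (hX j)
    · exact Ideal.sum_mem _ fun j _ => hX j
  refine ⟨[quadraticParam k n, linearParam k n], hrs, ⟨?_, ?_⟩, ?_⟩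
  · rw [RingTheory.Sequence.isWeaklyRegular_cons_iff,
      RingTheory.Sequence.isWeaklyRegular_cons_iff]
    refine ⟨?_, ?_, RingTheory.Sequence.IsWeaklyRegular.nil _ _⟩
    · intro u w huw
      have h1 : quadraticParam k n • (u - w) = 0 := by rw [smul_sub, sub_eq_zero]; exact huw
      exact sub_eq_zero.1 (quadraticParam_smul_eq_zero hn h1)
    · intro u w huw
      induction u using Submodule.Quotient.induction_on with | _ u =>
      induction w using Submodule.Quotient.induction_on with | _ w =>
      have h1 : linearParam k n • (u - w) ∈
          (quadraticParam k n • ⊤ :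
            Submodule (MvPolynomial (Fin n) k) (edgeModel α β).carrier) := by
        rw [smul_sub]
        exact (Submodule.Quotient.eq _).1 huw
      obtain ⟨w', -, hw'⟩ := h1
      obtain ⟨f, hf⟩ := exists_quadraticParam_smul hn (hw'.symm)
      refine (Submodule.Quotient.eq _).2 ?_
      exact ⟨f, trivial, hf.symm⟩
  · -- by Nakayama, an element congruent to `1` modulo the variables would kill an edge component
    intro htop
    have hfin := (edgeModel α β).finite
    obtain ⟨r, hr, hr'⟩ := Submodule.exists_sub_one_mem_and_smul_eq_zero_of_fg_of_le_smul _ _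
      hfin.1 htop.le
    have h := edgeModel_hasEdgeMaps hn hv
    let j : Fin n := ⟨0, by omega⟩
    have h1 := restrictVars_eq_zero_of_smul_eq_zero (h.c_mem j) (h.c_ne j) (hr' _ trivial)
    have h2 := coeff_restrictVars (cycEdge j) 0 r
    rw [h1, coeff_zero, if_pos (by simp)] at h2
    have h3 : r - 1 ∈ idealOfVars (Fin n) k := by
      refine (Ideal.span_le.2 ?_ : Ideal.ofList _ ≤ idealOfVars (Fin n) k) hr
      exact fun r hr => hrs r hr
    rw [← pow_one (idealOfVars (Fin n) k), mem_pow_idealOfVars_iff'] at h3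
    have h4 := h3 0 (by simp)
    rw [coeff_sub, ← h2, coeff_zero_one, zero_sub] at h4
    exact one_ne_zero (neg_eq_zero.1 h4)
  · refine le_antisymm ((edgeModel_isPolygonal hn hv).two_le_supportDim hn) ?_
    refine supportDim_le_of_forall_faceIdeal (d := 2) (fun j : Fin n => cycEdge j)
      (fun j => (card_cycEdge hn j).le) fun f hf (m : edgeSubmodule α β) => ?_
    refine Subtype.ext (ext_entry fun j => ?_)
    change restrictVars (cycEdge j) f * entry j m.1 = entry j 0
    rw [mem_faceIdeal.1 (hf j), zero_mul, map_zero]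

end ModelProperties

/-! ### Decomposability -/

section Decomposability

open EdgeFunctions SquareFreeModule

variable {k : Type u} [Field k] {n : ℕ} {α β : Fin n → k}

/-- A homogeneous element of a one-dimensional component lies in one of two complementary graded
submodules. -/
lemma SquareFreeModule.mem_or_mem_of_isCompl {M : SquareFreeModule k n}
    {N N' : Submodule (MvPolynomial (Fin n) k) M.carrier} (hN : M.IsGradedSubmodule N)
    (hN' : M.IsGradedSubmodule N') (hc : IsCompl N N') {a : Fin n → ℤ}
    (ha : Module.finrank k (M.deg a) = 1) {x : M.carrier} (hx : x ∈ M.deg a) :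
    x ∈ N ∨ x ∈ N' := by
  obtain ⟨p, hp, q, hq, hpq⟩ := Submodule.mem_sup.1
    (show x ∈ N ⊔ N' by rw [hc.sup_eq_top]; trivial)
  have h1 : M.comp a p + M.comp a q = x := by rw [← map_add, hpq, comp_of_mem hx]
  by_cases h0 : M.comp a p = 0
  · right
    rw [← h1, h0, zero_add]
    exact hN'.comp_mem hq a
  · left
    obtain ⟨r, rfl⟩ := exists_smul_eq_of_finrank_eq_one ha (M.comp_mem a p) h0 hx
    rw [← C_smul]
    exact N.smul_mem _ (hN.comp_mem hp a)

/-- If at most one of the structure maps vanishes, the edge components of the model all lie in the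
same summand of a decomposition. -/
lemma edgeModel_isIndecomposable (hn : 3 ≤ n) (hv : ∀ l, α (cycSucc n l) ≠ 0 ∨ β l ≠ 0)
    {i : Fin n} (hi : ∀ l, l ≠ i → α (cycSucc n l) ≠ 0 ∧ β l ≠ 0) :
    (edgeModel α β).IsIndecomposable := by
  have hM := edgeModel_isPolygonal hn hv
  have h := edgeModel_hasEdgeMaps hn hv
  set b := modelVertex α β hn
  set c := modelEdge α β hn
  refine ⟨⟨⟨c i, 0, h.c_ne i⟩⟩, fun N N' hN hN' hc => ?_⟩
  have hnot : ∀ j, c j ∈ N → c j ∉ N' := fun j h1 h2 =>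
    h.c_ne j (by simpa using (Submodule.disjoint_def.1 hc.disjoint) _ h1 h2)
  have hcj : ∀ j, c j ∈ N ∨ c j ∈ N' := fun j =>
    mem_or_mem_of_isCompl hN hN' hc (hM.finrank_edge hn j) (h.c_mem j)
  have step : ∀ (N : Submodule (MvPolynomial (Fin n) k) (edgeModel α β).carrier) (l : Fin n),
      l ≠ i → b (cycSucc n l) ∈ N → c l ∈ N ∧ c (cycSucc n l) ∈ N := by
    intro N l hl hb
    obtain ⟨h1, h2⟩ := hi l hl
    constructor
    · have h3 := N.smul_mem (X l) hb
      rw [h.right, ← C_smul] at h3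
      have h4 := N.smul_mem (C (β l)⁻¹) h3
      rwa [smul_smul, ← C_mul, inv_mul_cancel₀ h2, C_1, one_smul] at h4
    · have h3 := N.smul_mem (X (cycSucc n (cycSucc n l))) hb
      rw [h.left, ← C_smul] at h3
      have h4 := N.smul_mem (C (α (cycSucc n l))⁻¹) h3
      rwa [smul_smul, ← C_mul, inv_mul_cancel₀ h1, C_1, one_smul] at h4
  have hconn := cycle_connected (P := fun j => c j ∈ N) (i := i) (by
    intro l hl
    rcases mem_or_mem_of_isCompl hN hN' hc (hM.finrank_vertex (cycSucc n l)) (h.b_mem _) with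
      hb | hb
    · obtain ⟨h1, h2⟩ := step N l hl hb
      exact iff_of_true h1 h2
    · obtain ⟨h1, h2⟩ := step N' l hl hb
      exact iff_of_false (fun h' => hnot _ h' h1) (fun h' => hnot _ h' h2))
  -- every element becomes a combination of the edge elements after multiplication by `x_j x_{j+1}`
  have hbot : ∀ N N' : Submodule (MvPolynomial (Fin n) k) (edgeModel α β).carrier,
      Disjoint N N' → (∀ j, c j ∈ N) → N' = ⊥ := by
    intro N N' hd hN
    rw [eq_bot_iff]
    intro (f : edgeSubmodule α β) hf
    refine Subtype.ext (ext_entry fun j => ?_)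
    have h1 : (X j * X (cycSucc n j) : MvPolynomial (Fin n) k) • f =
        (entry j f.1 • (c j : edgeSubmodule α β)) := by
      refine Subtype.ext (ext_entry fun l => ?_)
      change restrictVars (cycEdge l) (X j * X (cycSucc n j)) * entry l f.1 =
        restrictVars (cycEdge l) (entry j f.1) * entry l (monomialTuple _ _)
      rw [monomialTuple_apply]
      by_cases hl : l = j
      · subst hl
        rw [restrictVars_X_mul_X, (f.2 l).1, Pi.single_eq_same, mul_comm, edgeExp, X, X,
          monomial_mul, mul_one]
      · rw [Pi.single_eq_of_ne hl, monomial_zero, mul_zero]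
        have h2 : restrictVars (cycEdge l)
            (X j * X (cycSucc n j) : MvPolynomial (Fin n) k) = 0 := by
          rw [map_mul, restrictVars_X, restrictVars_X]
          split_ifs with h3 h4
          · refine absurd (eq_of_cycEdge_subset hn fun i hi => ?_).symm hl
            rcases mem_cycEdge.1 hi with rfl | rfl
            · exact h3
            · exact h4
          all_goals simp
        rw [h2, zero_mul]
    have h2 : (X j * X (cycSucc n j) : MvPolynomial (Fin n) k) • f = 0 := by
      refine (Submodule.disjoint_def.1 hd) _ ?_ (N'.smul_mem _ hf)
      rw [h1]
      exact N.smul_mem _ (hN j)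
    have h3 : restrictVars (cycEdge j) (X j * X (cycSucc n j)) * entry j f.1 = entry j 0 :=
      congrArg (fun f : edgeSubmodule α β => entry j f.1) h2
    rw [restrictVars_X_mul_X, map_zero] at h3
    change entry j f.1 = entry j 0
    rw [map_zero]
    exact (mul_eq_zero.1 h3).resolve_left (mul_ne_zero (X_ne_zero _) (X_ne_zero _))
  by_cases hP : c i ∈ N
  · exact Or.inr (hbot N N' hc.disjoint fun j => (hconn j i).2 hP)
  · exact Or.inl (hbot N' N hc.disjoint.symm fun j =>
      (hcj j).resolve_left fun h' => hP ((hconn j i).1 h'))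

/-- The elements of the model supported on a set of edges. -/
def supportedOn (α β : Fin n → k) (T : Finset (Fin n)) :
    Submodule (MvPolynomial (Fin n) k) (edgeModel α β).carrier where
  carrier := {f : edgeSubmodule α β | ∀ j, j ∉ T → entry j f.1 = 0}
  zero_mem' j _ := map_zero _
  add_mem' {f g} hf hg j hj := by
    change entry j ((f : edgeSubmodule α β).1 + (g : edgeSubmodule α β).1) = 0
    rw [map_add, hf j hj, hg j hj, add_zero]
  smul_mem' r f hf j hj := by
    change restrictVars (cycEdge j) r * entry j (f : edgeSubmodule α β).1 = 0
    rw [hf j hj, mul_zero]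

lemma supportedOn_isGraded (T : Finset (Fin n)) :
    (edgeModel α β).IsGradedSubmodule (supportedOn α β T) := by
  refine le_antisymm (fun (f : edgeSubmodule α β) hf => ?_) (Submodule.span_le.2 fun m hm => hm.1)
  obtain ⟨D, hD⟩ := eq_sum_homogeneousPart f
  have h1 : ∀ d ∈ D, (show (edgeModel α β).carrier from homogeneousPart d f) ∈
      Submodule.span (MvPolynomial (Fin n) k)
        {m | m ∈ supportedOn α β T ∧ ∃ a, m ∈ (edgeModel α β).deg a} := by
    intro d _
    refine Submodule.subset_span ⟨fun j hj => ?_, expDegree d, homogeneousPart_mem_edgeDeg d f⟩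
    change entry j (monomialTuple d _) = 0
    rw [monomialTuple_apply, hf j hj, coeff_zero, monomial_zero]
  have h2 := Submodule.sum_mem _ h1
  exact hD ▸ h2

/-- Cutting the cycle at two vertices where a structure map vanishes decomposes the model. -/
lemma edgeModel_not_isIndecomposable (hn : 3 ≤ n) {i i' : Fin n} (hii : i ≠ i')
    (hi : α (cycSucc n i) = 0 ∨ β i = 0) (hi' : α (cycSucc n i') = 0 ∨ β i' = 0) :
    ¬ (edgeModel α β).IsIndecomposable := by
  obtain ⟨T, ⟨p, hp⟩, ⟨q, hq⟩, hT⟩ := exists_cycle_cut hii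
  -- restriction of a tuple to a set of edges bounded by `i` and `i'`
  have hcut : ∀ T : Finset (Fin n), (∀ j, j ≠ i → j ≠ i' → (j ∈ T ↔ cycSucc n j ∈ T)) →
      ∀ f : edgeSubmodule α β,
        EdgeFunctions.mk (fun j => if j ∈ T then entry j f.1 else 0) ∈ edgeSubmodule α β := by
    intro T hT f j
    obtain ⟨h1, h2⟩ := f.2 j
    rw [entry_mk, entry_mk]
    refine ⟨by split_ifs <;> simp [h1], ?_⟩
    by_cases hj : j = i ∨ j = i'
    · have hz : α (cycSucc n j) = 0 ∨ β j = 0 := by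
        rcases hj with rfl | rfl
        · exact hi
        · exact hi'
      have h3 : α (cycSucc n j) • restrictVars {cycSucc n j} (entry j f.1) = 0 := by
        rcases hz with hz | hz
        · rw [hz, zero_smul]
        · rw [h2, hz, zero_smul]
      have h4 : β j • restrictVars {cycSucc n j} (entry (cycSucc n j) f.1) = 0 := by
        rw [← h2, h3]
      split_ifs <;> simp only [map_zero, smul_zero, h3, h4]
    · push Not at hj
      have h3 := hT j hj.1 hj.2
      by_cases h4 : j ∈ T
      · rw [if_pos h4, if_pos (h3.1 h4), h2]
      · rw [if_neg h4, if_neg (fun h5 => h4 (h3.2 h5)), map_zero, smul_zero, smul_zero]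
  have hT' : ∀ j, j ≠ i → j ≠ i' → (j ∈ Tᶜ ↔ cycSucc n j ∈ Tᶜ) := by
    intro j h1 h2
    rw [Finset.mem_compl, Finset.mem_compl, hT j h1 h2]
  have hne : ∀ (T : Finset (Fin n)) (p : Fin n), p ∈ T → supportedOn α β T ≠ ⊥ := by
    intro T p hp hbot
    have h1 : modelEdge α β hn p ∈ supportedOn α β T := by
      intro j hj
      change entry j (monomialTuple _ _) = 0
      rw [monomialTuple_apply, Pi.single_eq_of_ne, monomial_zero]
      rintro rfl
      exact hj hp
    rw [hbot] at h1
    have h2 : entry p (monomialTuple (edgeExp p) (Pi.single p (1 : k))) = entry p 0 :=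
      congrArg (fun f : edgeSubmodule α β => entry p f.1) h1
    rw [monomialTuple_apply, Pi.single_eq_same, map_zero, monomial_eq_zero] at h2
    exact one_ne_zero h2
  intro hind
  have hc : IsCompl (supportedOn α β T) (supportedOn α β Tᶜ) := by
    constructor
    · rw [Submodule.disjoint_def]
      intro (f : edgeSubmodule α β) h1 h2
      refine Subtype.ext (ext_entry fun j => ?_)
      change entry j f.1 = entry j 0
      rw [map_zero]
      by_cases hj : j ∈ T
      · exact h2 j (by simpa using hj)
      · exact h1 j hj
    · rw [codisjoint_iff, eq_top_iff]
      rintro (f : edgeSubmodule α β) -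
      refine Submodule.mem_sup.2 ⟨(⟨_, hcut T hT f⟩ : edgeSubmodule α β), fun j hj => ?_,
        (⟨_, hcut Tᶜ hT' f⟩ : edgeSubmodule α β), fun j hj => ?_, ?_⟩
      · exact if_neg hj
      · exact if_neg hj
      · refine Subtype.ext (ext_entry fun j => ?_)
        change (if j ∈ T then entry j f.1 else 0) + (if j ∈ Tᶜ then entry j f.1 else 0) =
          entry j f.1
        by_cases hj : j ∈ T <;> simp [hj]
  rcases hind.2 _ _ (supportedOn_isGraded T) (supportedOn_isGraded Tᶜ) hc with h1 | h1
  · exact hne T p hp h1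
  · exact hne Tᶜ q (by simpa using hq) h1

lemma SquareFreeModule.IsIndecomposable.of_iso {M N : SquareFreeModule k n}
    (hM : M.IsIndecomposable) (h : M.Iso N) : N.IsIndecomposable := by
  obtain ⟨f, hf⟩ := h
  have hgr : ∀ P : Submodule (MvPolynomial (Fin n) k) N.carrier, N.IsGradedSubmodule P →
      M.IsGradedSubmodule (P.comap f.toLinearMap) := by
    intro P hP
    refine le_antisymm (fun m hm => ?_) (Submodule.span_le.2 fun m hm => hm.1)
    have h1 : f m ∈ Submodule.span (MvPolynomial (Fin n) k) {m | m ∈ P ∧ ∃ a, m ∈ N.deg a} :=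
      hP ▸ hm
    have h2 := Submodule.mem_map_of_mem (f := f.symm.toLinearMap) h1
    rw [Submodule.map_span] at h2
    simp only [LinearEquiv.coe_coe, LinearEquiv.symm_apply_apply] at h2
    refine Submodule.span_mono ?_ h2
    rintro _ ⟨x, ⟨hx, a, ha⟩, rfl⟩
    exact ⟨by simpa using hx, a, by rw [hf]; simpa using ha⟩
  obtain ⟨⟨x, y, hxy⟩⟩ := hM.1
  refine ⟨⟨f x, f y, fun h => hxy (f.injective h)⟩, fun P P' hP hP' hc => ?_⟩
  have hc' : IsCompl (P.comap f.toLinearMap) (P'.comap f.toLinearMap) :=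
    hc.map (Submodule.orderIsoMapComap f).symm
  have key : ∀ P : Submodule (MvPolynomial (Fin n) k) N.carrier,
      P.comap f.toLinearMap = ⊥ → P = ⊥ := by
    intro P hP
    rw [eq_bot_iff]
    intro x hx
    have h1 : f.symm x ∈ P.comap f.toLinearMap := by simpa using hx
    rw [hP] at h1
    simpa using h1
  exact (hM.2 _ _ (hgr P hP) (hgr P' hP') hc').imp (key P) (key P')

end Decomposability

/-! ### Change of bases -/

section Rescaling

open SquareFreeModule

variable {k : Type u} [Field k] {n : ℕ} {M : SquareFreeModule k n}
  {α β α' β' : Fin n → k} {b c b' c' : Fin n → M.carrier}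

lemma SquareFreeModule.HasEdgeMaps.rescale (h : M.HasEdgeMaps α β b c) {p q : Fin n → k}
    (hp : ∀ j, p j ≠ 0) (hq : ∀ j, q j ≠ 0) (hα : ∀ j, q j * α' j = p j * α j)
    (hβ : ∀ j, q j * β' j = p (cycSucc n j) * β j) :
    M.HasEdgeMaps α' β' (fun j => p j • b j) (fun j => q j • c j) where
  b_mem j := Submodule.smul_mem _ _ (h.b_mem j)
  b_ne j := smul_ne_zero (hp j) (h.b_ne j)
  c_mem j := Submodule.smul_mem _ _ (h.c_mem j)
  c_ne j := smul_ne_zero (hq j) (h.c_ne j)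
  left j := by rw [smul_smul_comm, h.left, smul_smul, smul_smul, ← hα, mul_comm]
  right j := by rw [smul_smul_comm, h.right, smul_smul, smul_smul, ← hβ, mul_comm]

lemma SquareFreeModule.HasEdgeMaps.exists_rescale (h : M.HasEdgeMaps α β b c)
    (h' : M.HasEdgeMaps α' β' b' c') (hM : M.IsPolygonal) (hn : 3 ≤ n) :
    ∃ p q : Fin n → k, (∀ j, p j ≠ 0) ∧ (∀ j, q j ≠ 0) ∧ (∀ j, q j * α' j = p j * α j) ∧
      ∀ j, q j * β' j = p (cycSucc n j) * β j := by
  choose p hp using fun j =>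
    exists_smul_eq_of_finrank_eq_one (hM.finrank_vertex j) (h.b_mem j) (h.b_ne j) (h'.b_mem j)
  choose q hq using fun j =>
    exists_smul_eq_of_finrank_eq_one (hM.finrank_edge hn j) (h.c_mem j) (h.c_ne j) (h'.c_mem j)
  refine ⟨p, q, fun j h0 => h'.b_ne j (by rw [hp, h0, zero_smul]),
    fun j h0 => h'.c_ne j (by rw [hq, h0, zero_smul]), fun j => ?_, fun j => ?_⟩
  · have h1 := h'.left j
    rw [hp, hq, smul_smul_comm, h.left, smul_smul, smul_smul] at h1
    rw [mul_comm, smul_left_injective k (h.c_ne j) h1]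
  · have h1 := h'.right j
    rw [hp, hq, smul_smul_comm, h.right, smul_smul, smul_smul] at h1
    rw [mul_comm, smul_left_injective k (h.c_ne j) h1]

lemma SquareFreeModule.HasEdgeMaps.of_iso {N : SquareFreeModule k n}
    (h : M.HasEdgeMaps α β b c) {f : M.carrier ≃ₗ[MvPolynomial (Fin n) k] N.carrier}
    (hf : ∀ a m, m ∈ M.deg a ↔ f m ∈ N.deg a) :
    N.HasEdgeMaps α β (fun j => f (b j)) (fun j => f (c j)) where
  b_mem j := (hf _ _).1 (h.b_mem j)
  b_ne j := fun h0 => h.b_ne j (f.injective (by rw [h0, map_zero]))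
  c_mem j := (hf _ _).1 (h.c_mem j)
  c_ne j := fun h0 => h.c_ne j (f.injective (by rw [h0, map_zero]))
  left j := by rw [← map_smul, h.left, ← C_smul, map_smul, C_smul]
  right j := by rw [← map_smul, h.right, ← C_smul, map_smul, C_smul]

/-- The family of scalars equal to `s` at `i` and to `1` elsewhere. -/
def oneExcept (i : Fin n) (s : k) : Fin n → k := fun j => if j = i then s else 1

lemma oneExcept_self (i : Fin n) (s : k) : oneExcept i s i = s := if_pos rfl

lemma oneExcept_of_ne {i j : Fin n} (h : j ≠ i) (s : k) : oneExcept i s j = 1 := if_neg h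

lemma prod_oneExcept (i : Fin n) (s : k) : ∏ j, oneExcept i s j = s := by
  simp [oneExcept]

lemma hasEdgeCoordinates_iff {i : Fin n} {s t : k} : M.HasEdgeCoordinates i s t ↔
    ∃ b c, M.HasEdgeMaps (oneExcept i s) (oneExcept i t) b c := by
  constructor
  · rintro ⟨b, c, hb, hc, hj, hs, ht⟩
    refine ⟨b, c, fun j => (hb j).1, fun j => (hb j).2, fun j => (hc j).1, fun j => (hc j).2,
      fun j => ?_, fun j => ?_⟩
    · by_cases h : j = i
      · subst h; rw [oneExcept_self]; exact hs
      · rw [oneExcept_of_ne h, one_smul]; exact (hj j h).1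
    · by_cases h : j = i
      · subst h; rw [oneExcept_self]; exact ht
      · rw [oneExcept_of_ne h, one_smul]; exact (hj j h).2
  · rintro ⟨b, c, h⟩
    refine ⟨b, c, fun j => ⟨h.b_mem j, h.b_ne j⟩, fun j => ⟨h.c_mem j, h.c_ne j⟩,
      fun j hj => ⟨?_, ?_⟩, ?_, ?_⟩
    · have := h.left j
      rwa [oneExcept_of_ne hj, one_smul] at this
    · have := h.right j
      rwa [oneExcept_of_ne hj, one_smul] at this
    · have := h.left i
      rwa [oneExcept_self] at this
    · have := h.right i
      rwa [oneExcept_self] at this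

lemma SquareFreeModule.HasEdgeCoordinates.of_iso {N : SquareFreeModule k n} {i : Fin n} {s t : k}
    (h : M.HasEdgeCoordinates i s t) (hMN : M.Iso N) : N.HasEdgeCoordinates i s t := by
  obtain ⟨b, c, h⟩ := hasEdgeCoordinates_iff.1 h
  obtain ⟨f, hf⟩ := hMN
  exact hasEdgeCoordinates_iff.2 ⟨_, _, h.of_iso hf⟩

/-- If the structure maps are nonzero at all edges but `e_i`, then they can be normalized to `1`
there. -/
lemma SquareFreeModule.HasEdgeMaps.exists_hasEdgeCoordinates (h : M.HasEdgeMaps α β b c)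
    {i : Fin n} (hi : ∀ j, j ≠ i → α j ≠ 0 ∧ β j ≠ 0) :
    ∃ s t, M.HasEdgeCoordinates i s t := by
  let g : Fin n → kˣ := fun j =>
    if hj : j ≠ i then Units.mk0 (α j / β j) (div_ne_zero (hi j hj).1 (hi j hj).2) else 1
  obtain ⟨p, hp⟩ := exists_cycle_potential g i
  refine ⟨p i * α i, p (cycSucc n i) * β i, hasEdgeCoordinates_iff.2 ⟨_, _,
    h.rescale (p := fun j => p j) (q := fun j => if j = i then 1 else p j * α j)
      (fun j => (p j).ne_zero) (fun j => ?_) (fun j => ?_) fun j => ?_⟩⟩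
  · split_ifs with hj
    · exact one_ne_zero
    · exact mul_ne_zero (p j).ne_zero (hi j hj).1
  · split_ifs with hj
    · subst hj; rw [oneExcept_self, one_mul]
    · rw [oneExcept_of_ne hj, mul_one]
  · split_ifs with hj
    · subst hj; rw [oneExcept_self, one_mul]
    · have h1 := (hi j hj).2
      rw [oneExcept_of_ne hj, hp j hj]
      simp only [g, dif_pos hj, Units.val_mul, Units.val_mk0]
      field_simp

/-- The invariant of the structure maps: the alternating product around the cycle. -/
lemma SquareFreeModule.HasEdgeCoordinates.mul_eq_mul {i i' : Fin n} {s t s' t' : k}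
    (h : M.HasEdgeCoordinates i s t) (h' : M.HasEdgeCoordinates i' s' t') (hM : M.IsPolygonal)
    (hn : 3 ≤ n) : s * t' = t * s' ∧ (i ≠ i' → s ≠ 0 ∧ t ≠ 0) := by
  obtain ⟨b, c, h⟩ := hasEdgeCoordinates_iff.1 h
  obtain ⟨b', c', h'⟩ := hasEdgeCoordinates_iff.1 h'
  obtain ⟨p, q, hp, hq, hα, hβ⟩ := h.exists_rescale h' hM hn
  constructor
  · have h1 : ∀ j, p j * (oneExcept i s j * oneExcept i' t' j) =
        p (cycSucc n j) * (oneExcept i t j * oneExcept i' s' j) := by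
      intro j
      rw [← mul_assoc, ← hα, ← mul_assoc, ← hβ]
      ring
    have h2 := Finset.prod_congr (rfl : (Finset.univ : Finset (Fin n)) = Finset.univ)
      fun j _ => h1 j
    simp only [Finset.prod_mul_distrib, prod_oneExcept] at h2
    rw [Equiv.prod_comp (cycSucc n) p] at h2
    exact mul_left_cancel₀ (Finset.prod_ne_zero_iff.2 fun j _ => hp j) h2
  · intro hii
    have h1 := hα i
    have h2 := hβ i
    rw [oneExcept_self, oneExcept_of_ne hii, mul_one] at h1 h2
    constructor
    · rintro rfl
      exact hq i (by rw [h1, mul_zero])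
    · rintro rfl
      exact hq i (by rw [h2, mul_zero])

/-- A common factor of `s` and `t` is absorbed by the basis element of the edge `e_i`. -/
lemma SquareFreeModule.HasEdgeCoordinates.smul {i : Fin n} {s t a : k} (ha : a ≠ 0)
    (h : M.HasEdgeCoordinates i s t) : M.HasEdgeCoordinates i (a * s) (a * t) := by
  obtain ⟨b, c, h⟩ := hasEdgeCoordinates_iff.1 h
  refine hasEdgeCoordinates_iff.2 ⟨_, _, h.rescale (p := fun _ => 1)
    (q := fun j => if j = i then a⁻¹ else 1) (fun j => one_ne_zero) (fun j => ?_)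
    (fun j => ?_) fun j => ?_⟩
  · split_ifs
    · exact inv_ne_zero ha
    · exact one_ne_zero
  all_goals
    by_cases hj : j = i
    · subst hj
      simp [oneExcept_self, ha]
    · simp [hj, oneExcept_of_ne hj]

end Rescaling

/-! ### The doubled line -/

section DoubledLine

variable {k : Type u} [Field k] {n : ℕ}

lemma vec_ne_zero_iff {s t : k} : ![s, t] ≠ 0 ↔ s ≠ 0 ∨ t ≠ 0 := by
  rw [← not_and_or, not_iff_not]
  simp

lemma exists_smul_of_mul_eq_mul {s t s' t' : k} (h : ![s, t] ≠ 0) (h' : ![s', t'] ≠ 0)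
    (he : s * t' = t * s') : ∃ a, a ≠ 0 ∧ s' = a * s ∧ t' = a * t := by
  rw [vec_ne_zero_iff] at h h'
  by_cases hs : s = 0
  · subst hs
    have ht : t ≠ 0 := h.resolve_left (by simp)
    have hs' : s' = 0 := by
      rw [zero_mul] at he
      exact (mul_eq_zero.1 he.symm).resolve_left ht
    have ht' : t' ≠ 0 := h'.resolve_left (by simp [hs'])
    exact ⟨t' / t, div_ne_zero ht' ht, by simp [hs'], by field_simp⟩
  · have hs' : s' ≠ 0 := by
      rintro rfl
      rw [mul_zero] at he
      exact (h'.resolve_left (by simp)) ((mul_eq_zero.1 he).resolve_left hs)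
    refine ⟨s' / s, div_ne_zero hs' hs, by field_simp, ?_⟩
    field_simp
    rw [mul_comm t', he, mul_comm]

lemma mk_eq_mk_iff_mul_eq_mul {s t s' t' : k} (h : ![s, t] ≠ 0) (h' : ![s', t'] ≠ 0) :
    Projectivization.mk k ![s, t] h = Projectivization.mk k ![s', t'] h' ↔ s * t' = t * s' := by
  rw [Projectivization.mk_eq_mk_iff']
  constructor
  · rintro ⟨a, ha⟩
    have h0 := congrFun ha 0
    have h1 := congrFun ha 1
    simp at h0 h1
    rw [← h0, ← h1]; ring
  · intro he
    obtain ⟨a, -, rfl, rfl⟩ := exists_smul_of_mul_eq_mul h' h (by rw [mul_comm, ← he, mul_comm])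
    exact ⟨a, by ext i; fin_cases i <;> simp⟩

lemma isCoordinatePoint_mk {s t : k} (h : ![s, t] ≠ 0) :
    IsCoordinatePoint (Projectivization.mk k ![s, t] h) ↔ s = 0 ∨ t = 0 := by
  rw [IsCoordinatePoint, mk_eq_mk_iff_mul_eq_mul, mk_eq_mk_iff_mul_eq_mul, or_comm]
  simp [eq_comm]

lemma chart_eq_chart_iff {i i' : Fin n} {s t s' t' : k} (h : ![s, t] ≠ 0) (h' : ![s', t'] ≠ 0) :
    DoubledLine.chart i (Projectivization.mk k ![s, t] h) =
        DoubledLine.chart i' (Projectivization.mk k ![s', t'] h') ↔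
      s * t' = t * s' ∧ (i ≠ i' → s ≠ 0 ∧ t ≠ 0) := by
  refine Quotient.eq.trans ?_
  change (_ = _ ∧ (i = i' ∨ ¬ IsCoordinatePoint (Projectivization.mk k ![s, t] h))) ↔ _
  rw [mk_eq_mk_iff_mul_eq_mul, isCoordinatePoint_mk, not_or, or_iff_not_imp_left]

lemma DoubledLine.exists_eq_chart (x : DoubledLine k n) :
    ∃ (i : Fin n) (s t : k) (h : ![s, t] ≠ 0),
      x = DoubledLine.chart i (Projectivization.mk k ![s, t] h) := by
  induction x using Quotient.inductionOn with
  | _ x =>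
  obtain ⟨i, p⟩ := x
  induction p using Projectivization.ind with
  | _ v hv =>
  have hv' : v = ![v 0, v 1] := by ext j; fin_cases j <;> rfl
  refine ⟨i, v 0, v 1, hv' ▸ hv, ?_⟩
  unfold DoubledLine.chart
  congr 3

end DoubledLine

/-! ### The parametrization -/

section Parametrization

open SquareFreeModule

variable {k : Type u} [Field k] {n : ℕ}

lemma JacobianModule.isPolygonal (M : JacobianModule k (polygonBoundary n)) : M.1.IsPolygonal :=
  ⟨M.2.1, M.2.2.2.2.1, M.2.2.2.2.2⟩

/-- An indecomposable module of the family has no two vertices at which structure maps vanish. -/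
lemma JacobianModule.eq_of_vertex_eq_zero (M : JacobianModule k (polygonBoundary n)) (hn : 3 ≤ n)
    {α β : Fin n → k} {b c : Fin n → M.1.carrier} (h : M.1.HasEdgeMaps α β b c) {l l' : Fin n}
    (hl : α (cycSucc n l) = 0 ∨ β l = 0) (hl' : α (cycSucc n l') = 0 ∨ β l' = 0) : l = l' := by
  by_contra hne
  exact edgeModel_not_isIndecomposable hn hne hl hl'
    (M.2.2.1.of_iso (h.iso_edgeModel M.isPolygonal hn M.2.2.2.1))

lemma JacobianModule.coord_ne_zero (M : JacobianModule k (polygonBoundary n)) (hn : 3 ≤ n)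
    {i : Fin n} {s t : k} (h : M.1.HasEdgeCoordinates i s t) : ![s, t] ≠ 0 := by
  obtain ⟨b, c, h⟩ := hasEdgeCoordinates_iff.1 h
  rw [vec_ne_zero_iff]
  by_contra! h0
  obtain ⟨l, hl⟩ := (cycSucc n).surjective i
  have h1 : l = i := M.eq_of_vertex_eq_zero hn h
    (Or.inl (by rw [hl, oneExcept_self, h0.1])) (Or.inr (by rw [oneExcept_self, h0.2]))
  rw [h1] at hl
  exact cycSucc_ne hn i hl

/-- Every module of the family has edge coordinates. -/
lemma JacobianModule.exists_hasEdgeCoordinates (M : JacobianModule k (polygonBoundary n))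
    (hn : 3 ≤ n) : ∃ i s t, M.1.HasEdgeCoordinates i s t := by
  obtain ⟨α, β, b, c, h⟩ := M.isPolygonal.exists_hasEdgeMaps hn
  obtain ⟨h0, hK⟩ := M.2.2.2.1.koszul (M.isPolygonal.two_le_supportDim hn)
  suffices ∃ i, ∀ j, j ≠ i → α j ≠ 0 ∧ β j ≠ 0 by
    obtain ⟨i, hi⟩ := this
    exact ⟨i, h.exists_hasEdgeCoordinates hi⟩
  by_cases hz : ∃ l, α (cycSucc n l) = 0 ∨ β l = 0
  · obtain ⟨l, hl⟩ := hz
    -- at the vertex `l + 1` exactly one of the two maps vanishes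
    have hother : ∀ l', l' ≠ l → α (cycSucc n l') ≠ 0 ∧ β l' ≠ 0 := by
      intro l' hl'
      by_contra hc
      rw [not_and_or, not_not, not_not] at hc
      exact hl' (M.eq_of_vertex_eq_zero hn h hc hl)
    rcases hl with hl | hl
    · refine ⟨cycSucc n l, fun j hj => ⟨?_, ?_⟩⟩
      · obtain ⟨l', rfl⟩ := (cycSucc n).surjective j
        exact (hother l' fun h' => hj (by rw [h'])).1
      · by_cases hjl : j = l
        · rw [hjl]
          exact (h.vertex_ne_zero h0 hK M.isPolygonal hn l).resolve_left (not_not.2 hl)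
        · exact (hother j hjl).2
    · refine ⟨l, fun j hj => ⟨?_, (hother j hj).2⟩⟩
      obtain ⟨l', rfl⟩ := (cycSucc n).surjective j
      by_cases hjl : l' = l
      · rw [hjl]
        exact (h.vertex_ne_zero h0 hK M.isPolygonal hn l).resolve_right (not_not.2 hl)
      · exact (hother l' hjl).1
  · push Not at hz
    refine ⟨⟨0, by omega⟩, fun j _ => ⟨?_, (hz j).2⟩⟩
    obtain ⟨l, rfl⟩ := (cycSucc n).surjective j
    exact (hz l).1

/-- Edge coordinates of a module depend only on the point of the doubled line. -/
lemma JacobianModule.hasEdgeCoordinates_of_chart_eq (M : JacobianModule k (polygonBoundary n))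
    (hn : 3 ≤ n) {i i' : Fin n} {s t s' t' : k} (h : ![s, t] ≠ 0) (h' : ![s', t'] ≠ 0)
    (he : DoubledLine.chart i (Projectivization.mk k ![s, t] h) =
      DoubledLine.chart i' (Projectivization.mk k ![s', t'] h'))
    (hM : M.1.HasEdgeCoordinates i s t) : M.1.HasEdgeCoordinates i' s' t' := by
  obtain ⟨h1, h2⟩ := (chart_eq_chart_iff h h').1 he
  obtain ⟨s'', t'', hM', h3⟩ : ∃ s'' t'', M.1.HasEdgeCoordinates i' s'' t'' ∧
      s'' * t' = t'' * s' := by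
    by_cases hii : i = i'
    · subst hii
      exact ⟨s, t, hM, h1⟩
    · obtain ⟨hs, ht⟩ := h2 hii
      obtain ⟨b, c, hE⟩ := hasEdgeCoordinates_iff.1 hM
      obtain ⟨s'', t'', hM'⟩ := hE.exists_hasEdgeCoordinates (i := i') (fun j _ => by
        by_cases hj : j = i
        · subst hj; rw [oneExcept_self, oneExcept_self]; exact ⟨hs, ht⟩
        · rw [oneExcept_of_ne hj, oneExcept_of_ne hj]; exact ⟨one_ne_zero, one_ne_zero⟩)
      have h3 := (hM.mul_eq_mul hM' M.isPolygonal hn).1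
      have h4 := M.coord_ne_zero hn hM'
      refine ⟨s'', t'', hM', ?_⟩
      rw [← mk_eq_mk_iff_mul_eq_mul h4 h', ← (mk_eq_mk_iff_mul_eq_mul h h4).2 h3,
        (mk_eq_mk_iff_mul_eq_mul h h').2 h1]
  obtain ⟨a, ha, rfl, rfl⟩ := exists_smul_of_mul_eq_mul (M.coord_ne_zero hn hM') h' h3
  exact hM'.smul ha

/-- The model with given edge coordinates, as a member of the family. -/
lemma JacobianModule.exists_of_coord (hn : 3 ≤ n) (i : Fin n) {s t : k} (h : ![s, t] ≠ 0) :
    ∃ M : JacobianModule k (polygonBoundary n),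
      M.1 = edgeModel (oneExcept i s) (oneExcept i t) ∧ M.1.HasEdgeCoordinates i s t := by
  rw [vec_ne_zero_iff] at h
  have hv : ∀ l, oneExcept i s (cycSucc n l) ≠ 0 ∨ oneExcept i t l ≠ 0 := by
    intro l
    by_cases hl : l = i
    · left
      rw [oneExcept_of_ne (by rw [hl]; exact cycSucc_ne hn i)]
      exact one_ne_zero
    · right
      rw [oneExcept_of_ne hl]
      exact one_ne_zero
  -- the only vertex at which a structure map may vanish
  obtain ⟨l₀, hl₀⟩ : ∃ l₀, ∀ l, l ≠ l₀ →
      oneExcept i s (cycSucc n l) ≠ 0 ∧ oneExcept i t l ≠ 0 := by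
    by_cases hs : s = 0
    · obtain ⟨l₀, rfl⟩ := (cycSucc n).surjective i
      refine ⟨l₀, fun l hl => ⟨?_, ?_⟩⟩
      · rw [oneExcept_of_ne fun h' => hl ((cycSucc n).injective h')]
        exact one_ne_zero
      · unfold oneExcept
        split_ifs
        · exact h.resolve_left (not_not.2 hs)
        · exact one_ne_zero
    · refine ⟨i, fun l hl => ⟨?_, ?_⟩⟩
      · unfold oneExcept
        split_ifs
        · exact hs
        · exact one_ne_zero
      · rw [oneExcept_of_ne hl]
        exact one_ne_zero
  have hP := edgeModel_isPolygonal hn hv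
  exact ⟨⟨edgeModel (oneExcept i s) (oneExcept i t), hP.isOver,
    edgeModel_isIndecomposable hn hv hl₀, edgeModel_isCM hn hv, hP.rank, hP.multidegree⟩, rfl,
    hasEdgeCoordinates_iff.2 ⟨_, _, edgeModel_hasEdgeMaps hn hv⟩⟩

/-- Two modules of the family with the same edge coordinates are isomorphic. -/
lemma JacobianFamily.mk_eq_mk_of_hasEdgeCoordinates (hn : 3 ≤ n) {i : Fin n} {s t : k}
    {M N : JacobianModule k (polygonBoundary n)} (hM : M.1.HasEdgeCoordinates i s t)
    (hN : N.1.HasEdgeCoordinates i s t) : JacobianFamily.mk M = JacobianFamily.mk N := by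
  obtain ⟨E, hE, -⟩ := JacobianModule.exists_of_coord hn i (M.coord_ne_zero hn hM)
  have key : ∀ M : JacobianModule k (polygonBoundary n), M.1.HasEdgeCoordinates i s t →
      JacobianFamily.mk M = JacobianFamily.mk E := by
    intro M hM
    obtain ⟨b, c, h⟩ := hasEdgeCoordinates_iff.1 hM
    refine Quotient.sound ?_
    change M.1.Iso E.1
    rw [hE]
    exact h.iso_edgeModel M.isPolygonal hn M.2.2.2.1
  rw [key M hM, key N hN]

end Parametrization

theorem mainTheorem5 {k : Type u} [Field k] (n : ℕ) (hn : 3 ≤ n) :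
    ∃ Φ : DoubledLine k n → JacobianFamily k (polygonBoundary n),
      Function.Bijective Φ ∧
      ∀ (i : Fin n) (s t : k) (hst : ![s, t] ≠ 0) (M : JacobianModule k (polygonBoundary n)),
        Φ (DoubledLine.chart i (Projectivization.mk k ![s, t] hst)) = JacobianFamily.mk M ↔
          M.1.HasEdgeCoordinates i s t := by
  have hex : ∀ x : DoubledLine k n, ∃ M : JacobianModule k (polygonBoundary n),
      ∃ (i : Fin n) (s t : k) (h : ![s, t] ≠ 0),
        x = DoubledLine.chart i (Projectivization.mk k ![s, t] h) ∧
          M.1.HasEdgeCoordinates i s t := by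
    intro x
    obtain ⟨i, s, t, h, hx⟩ := x.exists_eq_chart
    obtain ⟨M, -, hM⟩ := JacobianModule.exists_of_coord hn i h
    exact ⟨M, i, s, t, h, hx, hM⟩
  choose F hF using hex
  have key : ∀ (i : Fin n) (s t : k) (hst : ![s, t] ≠ 0)
      (M : JacobianModule k (polygonBoundary n)),
      JacobianFamily.mk (F (DoubledLine.chart i (Projectivization.mk k ![s, t] hst))) =
        JacobianFamily.mk M ↔ M.1.HasEdgeCoordinates i s t := by
    intro i s t hst M
    obtain ⟨i', s', t', h', he, hM'⟩ := hF (DoubledLine.chart i (Projectivization.mk k ![s, t] hst))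
    have h1 := (F _).hasEdgeCoordinates_of_chart_eq hn h' hst he.symm hM'
    exact ⟨fun h => h1.of_iso (Quotient.exact h),
      fun h => JacobianFamily.mk_eq_mk_of_hasEdgeCoordinates hn h1 h⟩
  refine ⟨fun x => JacobianFamily.mk (F x), ⟨fun x y hxy => ?_, fun M => ?_⟩, key⟩
  · obtain ⟨i, s, t, h, rfl⟩ := x.exists_eq_chart
    obtain ⟨i', s', t', h', rfl⟩ := y.exists_eq_chart
    have h1 := (key i s t h _).1 hxy
    have h2 := (key i' s' t' h' _).1 rfl
    exact (chart_eq_chart_iff h h').2 (h1.mul_eq_mul h2 (F _).isPolygonal hn)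
  · induction M using Quotient.inductionOn with
    | _ M =>
    obtain ⟨i, s, t, hM⟩ := M.exists_hasEdgeCoordinates hn
    exact ⟨_, (key i s t (M.coord_ne_zero hn hM) M).2 hM⟩
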